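/- Let $N\ge 2$, $\Lambda>0$, $c>0$, and let $k_i=-\Lambda/2+i\Lambda/N$ ($i=1,\dots,N$) be the rapidity grid. Let $K_{ij}=\frac{\Lambda}{N}\mathcal K(k_i,k_j)$ with the Lieb–Liniger kernel $\mathcal K(k,k')=-\frac{1}{2\pi}\frac{2c}{c^2+(k-k')^2}$, let $T_{ij}(\theta)=K_{ij}\theta^j$ and $U(\theta)=(1+T(\theta))^{-1}$. Put $P'_i=\sum_jU_{ij}$, $E'_i=\sum_jU_{ij}k_j$, $v_i=E'_i/P'_i$, $\rho_i=\frac1{2\pi}P'_i\theta^i$, and for $n\ge1$ let $q^{(n)}(k)=k^n/n$, $q^{(n)}_i=q^{(n)}(k_i)$, $q^{(n)\prime}_i=k_i^{n-1}$, $Q^{(n)\prime}_i=\sum_jU_{ij}q^{(n)\prime}_j$. Let $\mathcal S\subset\mathbb R^N$ be an open neighbourhood of $0$ on which $1+T(\theta)$ is invertible and all $P'_i(\theta)\neq0$. Consider functionals $I[\theta]=\int h(\theta(x))\,dx$ of smooth fields $\theta(x)\in\mathcal S$, with $\delta I/\delta\theta^i=\partial_ih(\theta(x))$, and the bracket $$\{I,J\}=\sum_{i,j}\int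 dx\,\frac{\delta I}{\delta\theta^i}A^{ij}\frac{\delta J}{\delta\theta^j},\qquad A^{ij}=g^{ii}\delta^{ij}\frac{d}{dx}-\sum_kg^{ii}\Gamma^j_{ik}\theta^k_x-\sum_{m=1}^N\chi^{(m)}_i\theta^i_x\,d_x^{-1}\,\chi^{(m)}_j\theta^j_x,$$ where $g_{ii}=(P'_i)^2$, $\Gamma$ are the Christoffel symbols of this diagonal metric, and $\chi^{(m)}_j=\frac1{P'_j}\sum_kU_{jk}K_{km}$. Here $d_x^{-1}$ denotes a linear right inverse of the total $x$-derivative on expressions $\sum_j\omega_j(\theta)\theta^j_x$ that are total derivatives $\frac{d}{dx}F(\theta)$ of smooth functions $F$ on $\mathcal S$; it takes values in functions of $\theta\in\mathcal S$ and is unique up to the choice of the constants of integration. For $n=0,1,\dots,N-1$ let $$\mathcal Q^{(0)}=\int dx\sum_i\tfrac{\Lambda}{N}\rho_i,\qquad \mathcal Q^{(n)}=\int dx\sum_i\tfrac{\Lambda}{N}\rho_i\,q^{(n)}_i\ (n\ge1),\qquad H^{(n)}=-\pi\int dx\sum_i\rho_i\theta^i\,q^{(n+1)\prime}_i,\qquad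 w^{(n)}_i=\frac{Q^{(n+1)\prime}_i}{P'_i}.$$ 1. The particle number $\mathcal Q^{(0)}$ and the first $N-1$ higher charges $\mathcal Q^{(1)},\dots,\mathcal Q^{(N-1)}$ are first integrals of the discretized Bethe–Boltzmann system $\partial_t\theta^i+v_i(\theta)\partial_x\theta^i=0$ and their densities are functionally independent: their differentials are linearly independent at every point of $\mathcal S$. The $H^{(n)}$, $0\le n\le N-1$, are first integrals of this system as well. 2. The vector fields $w^{(0)},\dots,w^{(N-1)}$ (the dressed group velocities) are linearly independent at every point of $\mathcal S$; they are weakly nonlinear semi-Hamiltonian (that is, $\partial_iw_i=0$ and $\partial_jw_i=\Gamma^i_{ij}(w_j-w_i)$ for $i\ne j$, where $\partial_k\Gamma^i_{ij}=\partial_j\Gamma^i_{ik}$ for distinct $i,j,k$); and the flows $\partial_t\theta^i+w^{(n)}_i(\theta)\partial_x\theta^i=0$ commute with one another. 3. There is one choice of $d_x^{-1}$ for which, simultaneously for all $n=0,\dots,N-1$, $\mathcal Q^{(n)}$ is a Casimir, i.e. $\sum_jA^{ij}\,\delta\mathcal Q^{(n)}/\delta\theta^j=0$ for all $i$ and all smooth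 fields in $\mathcal S$, and $H^{(n)}$ generates the flow $w^{(n)}$, i.e. $\{\theta^i,H^{(n)}\}=-w^{(n)}_i(\theta)\,\theta^i_x$. (In particular, all expressions to which $d_x^{-1}$ is applied here are total derivatives.) 4. For every choice of $d_x^{-1}$ and all $m,n=0,\dots,N-1$, $$\{\mathcal Q^{(m)},\mathcal Q^{(n)}\}=0,\qquad\{H^{(m)},\mathcal Q^{(n)}\}=0,\qquad\{H^{(m)},H^{(n)}\}=0,$$ on smooth fields on the compactified real line, i.e. smooth $\theta:\mathbb R\to\mathcal S$ with $\theta_x$ integrable and $\theta(x)$ tending to one and the same point of $\mathcal S$ as $x\to\pm\infty$; the integrals defining these brackets converge absolutely. -/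

import Mathlib

open scoped BigOperators ContDiff Matrix
open MeasureTheory Filter Topology

noncomputable section

namespace BetheBoltzmann

/-- The target space `ℝ^N`, with coordinates `θ^1, …, θ^N`. -/
abbrev Target (N : ℕ) : Type := Fin N → ℝ

/-- The coordinate partial derivative `∂f/∂θ^j`. -/
def pd {N : ℕ} (f : Target N → ℝ) (j : Fin N) (θ : Target N) : ℝ :=
  fderiv ℝ f θ (Pi.single j 1)

/-! ### The `N`-point discretization of the Lieb-Liniger gas -/

/-- The rapidity grid points `k_i = -Λ/2 + i Λ/N`, `i = 1, …, N`
(the index `i : Fin N` stands for the `(i+1)`-st point). -/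
def node (N : ℕ) (Λ : ℝ) (i : Fin N) : ℝ := -Λ / 2 + ((i : ℕ) + 1 : ℝ) * (Λ / N)

/-- The Lieb-Liniger kernel with coupling `c`,
`𝒦(k,k') = -(1/2π) · 2c / (c² + (k-k')²)`. -/
def kernel (c k k' : ℝ) : ℝ := -(1 / (2 * Real.pi)) * (2 * c / (c ^ 2 + (k - k') ^ 2))

/-- The matrix `K_{ij} = (Λ/N) 𝒦(k_i,k_j)`. -/
def kernelMatrix (N : ℕ) (Λ c : ℝ) : Matrix (Fin N) (Fin N) ℝ :=
  Matrix.of fun i j => Λ / N * kernel c (node N Λ i) (node N Λ j)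

/-- The bare charge `q^{(n)}(k) = k^n / n`, meaningful for `n ≥ 1`. -/
def charge (n : ℕ) (k : ℝ) : ℝ := k ^ n / n

/-- The vector `q^{(n)}'_i` of rapidity derivatives of a bare charge at the grid points. -/
def chargeDeriv (N : ℕ) (Λ : ℝ) (n : ℕ) (i : Fin N) : ℝ := deriv (charge n) (node N Λ i)

/-- The matrix `1 + T(θ)`, with `T_{ij}(θ) = K_{ij} θ^j`. -/
def onePlusT (N : ℕ) (Λ c : ℝ) (θ : Target N) : Matrix (Fin N) (Fin N) ℝ :=
  Matrix.of fun i j => (if i = j then 1 else 0) + kernelMatrix N Λ c i j * θ j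

/-- The dressing operator `U(θ) = (1 + T(θ))⁻¹`. -/
def dressing (N : ℕ) (Λ c : ℝ) (θ : Target N) : Matrix (Fin N) (Fin N) ℝ :=
  (onePlusT N Λ c θ)⁻¹

/-- The dressed vector `∑_j U_{ij}(θ) a_j`. -/
def dress (N : ℕ) (Λ c : ℝ) (a : Fin N → ℝ) (i : Fin N) (θ : Target N) : ℝ :=
  ∑ j, dressing N Λ c θ i j * a j

/-- The dressed momentum derivative `P'_i(θ) = ∑_j U_{ij}(θ)`. -/
def momentumDeriv (N : ℕ) (Λ c : ℝ) (i : Fin N) (θ : Target N) : ℝ :=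
  dress N Λ c (fun _ => 1) i θ

/-- The dressed energy derivative `E'_i(θ) = ∑_j U_{ij}(θ) k_j`. -/
def energyDeriv (N : ℕ) (Λ c : ℝ) (i : Fin N) (θ : Target N) : ℝ :=
  dress N Λ c (node N Λ) i θ

/-- The quasiparticle velocity `v_i = E'_i / P'_i`. -/
def velocity (N : ℕ) (Λ c : ℝ) (i : Fin N) (θ : Target N) : ℝ :=
  energyDeriv N Λ c i θ / momentumDeriv N Λ c i θ

/-- The dressed group velocity `w^{(n)}_i = Q^{(n+1)}'_i / P'_i`, where `Q^{(n+1)}'` is the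
dressed vector `q^{(n+1)}'`. -/
def groupVelocity (N : ℕ) (Λ c : ℝ) (n : ℕ) (i : Fin N) (θ : Target N) : ℝ :=
  dress N Λ c (chargeDeriv N Λ (n + 1)) i θ / momentumDeriv N Λ c i θ

/-- The pseudo-momentum density `ρ_i = ρ^t_i θ^i`, with total density of states
`ρ^t_i = P'_i / 2π`. -/
def density (N : ℕ) (Λ c : ℝ) (i : Fin N) (θ : Target N) : ℝ :=
  1 / (2 * Real.pi) * momentumDeriv N Λ c i θ * θ i

/-- The density of `𝒬^{(n)}`: `∑_i (Λ/N) ρ_i` for `n = 0` (particle number) and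
`∑_i (Λ/N) ρ_i q^{(n)}_i` for `n ≥ 1`. -/
def chargeDensity (N : ℕ) (Λ c : ℝ) (n : ℕ) (θ : Target N) : ℝ :=
  ∑ i, Λ / N * density N Λ c i θ * (if n = 0 then 1 else charge n (node N Λ i))

/-- The density of `H^{(n)}`: `-π ∑_i ρ_i θ^i q^{(n+1)}'_i`. -/
def hamiltonianDensity (N : ℕ) (Λ c : ℝ) (n : ℕ) (θ : Target N) : ℝ :=
  -Real.pi * ∑ i, density N Λ c i θ * θ i * chargeDeriv N Λ (n + 1) i

/-! ### The metric and the coefficients of the bracket -/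

/-- The diagonal metric `g_{ii} = (P'_i)²`. -/
def metric (N : ℕ) (Λ c : ℝ) (θ : Target N) : Matrix (Fin N) (Fin N) ℝ :=
  Matrix.diagonal fun i => momentumDeriv N Λ c i θ ^ 2

/-- The Christoffel symbols `Γ^j_{ik}` of the (Levi-Civita connection of the) metric; the upper
index is the first argument. -/
def christoffel (N : ℕ) (Λ c : ℝ) (j i k : Fin N) (θ : Target N) : ℝ :=
  1 / 2 * ∑ l, (metric N Λ c θ)⁻¹ j l *
    (pd (fun η => metric N Λ c η l k) i θ + pd (fun η => metric N Λ c η i l) k θ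
      - pd (fun η => metric N Λ c η i k) l θ)

/-- The affinors `χ^{(m)}_j = (∑_k U_{jk} K_{km}) / P'_j`. -/
def affinor (N : ℕ) (Λ c : ℝ) (m j : Fin N) (θ : Target N) : ℝ :=
  dress N Λ c (fun k => kernelMatrix N Λ c k m) j θ / momentumDeriv N Λ c j θ

/-! ### Fields, the inverse of `d/dx`, and the bracket -/

/-- Smooth fields `x ↦ θ(x)` with values in `S`. -/
def IsField {N : ℕ} (S : Set (Target N)) (u : ℝ → Target N) : Prop :=
  ContDiff ℝ ∞ u ∧ ∀ x, u x ∈ S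

/-- Smooth fields on the compactified real line: `θ(x)` has the same limit, a point of `S`, at
both ends, and `θ_x` is integrable. -/
def IsCompactField {N : ℕ} (S : Set (Target N)) (u : ℝ → Target N) : Prop :=
  IsField S u ∧ (∃ p ∈ S, Tendsto u atTop (𝓝 p) ∧ Tendsto u atBot (𝓝 p)) ∧
    Integrable (deriv u)

/-- The `x`-derivative `θ^j_x`. -/
def dx {N : ℕ} (u : ℝ → Target N) (j : Fin N) (x : ℝ) : ℝ := deriv (fun y => u y j) x

/-- The expression `∑_j σ_j(θ) θ^j_x`, encoded by its coefficients `σ_1, …, σ_N`, is a total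
`x`-derivative `d/dx F(θ)` of a smooth function `F` on `S`. -/
def IsTotalDerivative {N : ℕ} (S : Set (Target N)) (σ : Target N → Fin N → ℝ) : Prop :=
  ∃ F : Target N → ℝ, ContDiffOn ℝ ∞ F S ∧ ∀ θ ∈ S, ∀ j, σ θ j = pd F j θ

/-- `D` is a realization of the inverse differential operator `d_x⁻¹` on the hydrodynamic
expressions `∑_j σ_j(θ) θ^j_x` that are total `x`-derivatives: a linear right inverse of the total
`x`-derivative. `D σ` is the function on `S` whose composite with `θ(x)` is
`d_x⁻¹ (∑_j σ_j(θ) θ^j_x)`. Such an operator amounts to a (linear) choice of the constants of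
integration. The first clause says that `D σ` on `S` depends on `σ` on `S` only. -/
structure IsInverseDx {N : ℕ} (S : Set (Target N))
    (D : (Target N → Fin N → ℝ) →ₗ[ℝ] (Target N → ℝ)) : Prop where
  congr_on : ∀ σ σ' : Target N → Fin N → ℝ, Set.EqOn σ σ' S → Set.EqOn (D σ) (D σ') S
  right_inv : ∀ σ, IsTotalDerivative S σ → ∀ u, IsField S u → ∀ x,
    HasDerivAt (fun y => D σ (u y)) (∑ j, σ (u x) j * dx u j x) x

/-- The variational derivative `δJ/δθ^j(x) = (∂h/∂θ^j)(θ(x))` of the functional of hydrodynamic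
type `J[θ] = ∫ h(θ(x)) dx`. Functionals of hydrodynamic type are given by their densities `h`. -/
def varDeriv {N : ℕ} (h : Target N → ℝ) (u : ℝ → Target N) (j : Fin N) (x : ℝ) : ℝ :=
  pd h j (u x)

/-- The coefficients `χ^{(m)}_j ∂h/∂θ^j` of the expression `∑_j χ^{(m)}_j θ^j_x δJ/δθ^j` to which
`d_x⁻¹` is applied. -/
def nonlocalForm (N : ℕ) (Λ c : ℝ) (h : Target N → ℝ) (m : Fin N) (θ : Target N) (j : Fin N) : ℝ :=
  affinor N Λ c m j θ * pd h j θ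

/-- The functional with density `h` is in the domain of the nonlocal operator: the arguments of
`d_x⁻¹` are total `x`-derivatives. -/
def InDomain (N : ℕ) (Λ c : ℝ) (S : Set (Target N)) (h : Target N → ℝ) : Prop :=
  ContDiffOn ℝ ∞ h S ∧ ∀ m, IsTotalDerivative S (nonlocalForm N Λ c h m)

/-- `{θ^i(x), J} = ∑_j A^{ij} δJ/δθ^j`, where
`A^{ij} = g^{ii} δ^{ij} d/dx - g^{ii} Γ^j_{ik} θ^k_x
  - ∑_m χ^{(m)}_i θ^i_x d_x⁻¹ χ^{(m)}_j θ^j_x`. -/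
def hamVector (N : ℕ) (Λ c : ℝ) (D : (Target N → Fin N → ℝ) →ₗ[ℝ] (Target N → ℝ))
    (h : Target N → ℝ) (u : ℝ → Target N) (i : Fin N) (x : ℝ) : ℝ :=
  (metric N Λ c (u x))⁻¹ i i * deriv (varDeriv h u i) x
    - (metric N Λ c (u x))⁻¹ i i *
        ∑ j, ∑ k, christoffel N Λ c j i k (u x) * dx u k x * varDeriv h u j x
    - ∑ m, affinor N Λ c m i (u x) * dx u i x * D (nonlocalForm N Λ c h m) (u x)

/-- The integrand of `{I,J} = ∫ ∑_{i,j} (δI/δθ^i) A^{ij} (δJ/δθ^j) dx`. -/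
def bracketIntegrand (N : ℕ) (Λ c : ℝ) (D : (Target N → Fin N → ℝ) →ₗ[ℝ] (Target N → ℝ))
    (hI hJ : Target N → ℝ) (u : ℝ → Target N) (x : ℝ) : ℝ :=
  ∑ i, varDeriv hI u i x * hamVector N Λ c D hJ u i x

/-- The bracket `{I,J}` of the functionals with densities `hI`, `hJ`, evaluated at the field. -/
def bracket (N : ℕ) (Λ c : ℝ) (D : (Target N → Fin N → ℝ) →ₗ[ℝ] (Target N → ℝ))
    (hI hJ : Target N → ℝ) (u : ℝ → Target N) : ℝ :=
  ∫ x, bracketIntegrand N Λ c D hI hJ u x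

/-- `{I,J} = 0` at every field on the compactified real line, the defining integral being
convergent. -/
def BracketVanishes (N : ℕ) (Λ c : ℝ) (S : Set (Target N))
    (D : (Target N → Fin N → ℝ) →ₗ[ℝ] (Target N → ℝ)) (hI hJ : Target N → ℝ) : Prop :=
  ∀ u, IsCompactField S u →
    Integrable (bracketIntegrand N Λ c D hI hJ u) ∧ bracket N Λ c D hI hJ u = 0

/-- The functional with density `h` is a Casimir: it lies in the kernel of the bracket. -/
def IsCasimir (N : ℕ) (Λ c : ℝ) (S : Set (Target N))
    (D : (Target N → Fin N → ℝ) →ₗ[ℝ] (Target N → ℝ)) (h : Target N → ℝ) : Prop :=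
  InDomain N Λ c S h ∧ ∀ u, IsField S u → ∀ i x, hamVector N Λ c D h u i x = 0

/-- The right-hand side of the flow `∂_t θ^i = -w_i(θ) ∂_x θ^i`. -/
def flowField {N : ℕ} (w : Fin N → Target N → ℝ) (u : ℝ → Target N) (x : ℝ) : Target N :=
  fun i => -w i (u x) * dx u i x

/-- The Hamiltonian with density `h` generates the flow `∂_t θ^i + w_i(θ) ∂_x θ^i = 0`, that is,
`{θ^i, H} = -w_i(θ) θ^i_x`. -/
def Generates (N : ℕ) (Λ c : ℝ) (S : Set (Target N))
    (D : (Target N → Fin N → ℝ) →ₗ[ℝ] (Target N → ℝ)) (h : Target N → ℝ)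
    (w : Fin N → Target N → ℝ) : Prop :=
  InDomain N Λ c S h ∧
    ∀ u, IsField S u → ∀ i x, hamVector N Λ c D h u i x = flowField w u x i

/-! ### Flows and first integrals -/

/-- The flows `∂_t θ^i = -w_i θ^i_x` and `∂_s θ^i = -w'_i θ^i_x` commute: the derivative of each of
the two evolutionary vector fields along the other one agree, at every field. -/
def FlowsCommute {N : ℕ} (S : Set (Target N)) (w w' : Fin N → Target N → ℝ) : Prop :=
  ∀ u, IsField S u → ∀ x i,
    deriv (fun ε : ℝ => flowField w (fun y => u y + ε • flowField w' u y) x i) 0 =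
      deriv (fun ε : ℝ => flowField w' (fun y => u y + ε • flowField w u y) x i) 0

/-- `w` is a weakly nonlinear semi-Hamiltonian flow: it is linearly degenerate, it solves
`∂_j w_i = Γ^i_{ij} (w_j - w_i)` for `i ≠ j`, and the coefficients `Γ^i_{ij}` have the
semi-Hamiltonian property. -/
def IsWNSFlow (N : ℕ) (Λ c : ℝ) (S : Set (Target N)) (w : Fin N → Target N → ℝ) : Prop :=
  (∀ i, ContDiffOn ℝ ∞ (w i) S) ∧
  (∀ θ ∈ S, ∀ i, pd (w i) i θ = 0) ∧
  (∀ θ ∈ S, ∀ i j, i ≠ j → pd (w i) j θ = christoffel N Λ c i i j θ * (w j θ - w i θ)) ∧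
  (∀ θ ∈ S, ∀ i j k, i ≠ j → j ≠ k → i ≠ k →
    pd (christoffel N Λ c i i j) k θ = pd (christoffel N Λ c i i k) j θ)

/-- `u = u(t,x)` is a continuously differentiable solution, with values in `S`, of the
system `∂_t θ^i + v_i(θ) ∂_x θ^i = 0` on the open set `O` of space-time. -/
def IsSolution {N : ℕ} (S : Set (Target N)) (v : Fin N → Target N → ℝ) (O : Set (ℝ × ℝ))
    (u : ℝ × ℝ → Target N) : Prop :=
  IsOpen O ∧ ContDiffOn ℝ 1 u O ∧ (∀ p ∈ O, u p ∈ S) ∧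
    ∀ p ∈ O, ∀ i, fderiv ℝ u p (1, 0) i + v i (u p) * fderiv ℝ u p (0, 1) i = 0

/-- The functional with density `h` is a first integral of `∂_t θ^i + v_i(θ) ∂_x θ^i = 0`: there is
a flux `G(θ)` such that `∂_t h(θ) + ∂_x G(θ) = 0` along all solutions. -/
def IsFirstIntegral {N : ℕ} (S : Set (Target N)) (v : Fin N → Target N → ℝ)
    (h : Target N → ℝ) : Prop :=
  ContDiffOn ℝ ∞ h S ∧ ∃ G : Target N → ℝ, ContDiffOn ℝ ∞ G S ∧
    ∀ O u, IsSolution S v O u → ∀ p ∈ O,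
      fderiv ℝ (fun q => h (u q)) p (1, 0) + fderiv ℝ (fun q => G (u q)) p (0, 1) = 0

/-- Functions on `S` are functionally independent: their differentials are linearly
independent at each point. -/
def FunctionallyIndependent {N : ℕ} (S : Set (Target N)) (h : Fin N → Target N → ℝ) : Prop :=
  ∀ θ ∈ S, LinearIndependent ℝ fun n : Fin N => fun j : Fin N => pd (h n) j θ

end BetheBoltzmann

end

/-! Write `V = U K` for the dressed kernel; it is symmetric because `K` is. Differentiating `(1 + T)
U b = b` gives the single rule `∂_j (U b)_i = -V_{ij} (U b)_j` (`pd_dress`), and everything rests on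
it.

All densities and fluxes are instances of `potential b q a`. Its gradient factors as `(U b)_j B_j`,
where the slope `B_j` does not depend on `b` (`pd_potential`). Taking `b = 1` gives the charges (`a
= 0`) and the Hamiltonians (`q = 0`); replacing `b = 1` by the vector of nodes multiplies each
partial derivative by `v_j`, so it produces the flux, and conservation follows.

For a density with `b = 1`, the local part of the bracket collapses to `-(θ^i_x / P'_i) (a_i + ∑_j
V_{ij} B_j)`, and the `m`-th nonlocal form `∑_j V_{mj} B_j θ^j_x` is the total derivative of `-(B_m
+ a_m θ_m)`. If `d_x⁻¹` returns this primitive plus a constant `C_m`, the Hamiltonian vector is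
`-(θ^i_x / P'_i) (U (a + K C))_i` (`hamVector_potential`). With `C = 0` the case `a = 0` is a
Casimir and the case `a = q^{(n+1)}'` generates `w^{(n)}`. With arbitrary `C` the integrand of a
bracket is minus the total derivative of `potential (a' + K C) q a`, hence integrates to zero
between equal limits (`bracketVanishes_potential`).

A linear `d_x⁻¹` with all `C_m = 0` exists only if every linear relation between the nonlocal forms
also holds between the chosen primitives. This is `sum_primitive_eq_zero`; it uses that `K` is
invertible with nonzero entries. Invertibility follows from definiteness, the Lorentzian being the
Fourier transform of a positive function. -/

noncomputable section

namespace BetheBoltzmann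

/-! ### Partial derivatives -/

section Calculus

variable {N : ℕ} {f g : Target N → ℝ} {θ : Target N}

theorem pd_add (hf : DifferentiableAt ℝ f θ) (hg : DifferentiableAt ℝ g θ) (j : Fin N) :
    pd (fun η => f η + g η) j θ = pd f j θ + pd g j θ := by
  simp [pd, fderiv_fun_add hf hg]

theorem pd_sub (hf : DifferentiableAt ℝ f θ) (hg : DifferentiableAt ℝ g θ) (j : Fin N) :
    pd (fun η => f η - g η) j θ = pd f j θ - pd g j θ := by
  simp [pd, fderiv_fun_sub hf hg]

theorem pd_mul (hf : DifferentiableAt ℝ f θ) (hg : DifferentiableAt ℝ g θ) (j : Fin N) :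
    pd (fun η => f η * g η) j θ = f θ * pd g j θ + pd f j θ * g θ := by
  simp [pd, fderiv_fun_mul hf hg, mul_comm]

theorem pd_const (r : ℝ) (j : Fin N) : pd (fun _ => r) j θ = 0 := by
  simp [pd]

theorem pd_const_mul (hf : DifferentiableAt ℝ f θ) (r : ℝ) (j : Fin N) :
    pd (fun η => r * f η) j θ = r * pd f j θ := by
  rw [pd_mul (differentiableAt_const r) hf, pd_const]; ring

theorem pd_sum {ι : Type*} (s : Finset ι) {F : ι → Target N → ℝ}
    (hF : ∀ i ∈ s, DifferentiableAt ℝ (F i) θ) (j : Fin N) :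
    pd (fun η => ∑ i ∈ s, F i η) j θ = ∑ i ∈ s, pd (F i) j θ := by
  simp [pd, fderiv_fun_sum hF]

theorem pd_coord (i j : Fin N) : pd (fun η => η i) j θ = if i = j then 1 else 0 := by
  have : HasFDerivAt (fun η : Target N => η i)
      (ContinuousLinearMap.proj (R := ℝ) (φ := fun _ : Fin N => ℝ) i) θ :=
    (ContinuousLinearMap.proj (R := ℝ) (φ := fun _ : Fin N => ℝ) i).hasFDerivAt
  simp [pd, this.fderiv, Pi.single_apply]

theorem pd_div (hf : DifferentiableAt ℝ f θ) (hg : DifferentiableAt ℝ g θ) (h0 : g θ ≠ 0)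
    (j : Fin N) :
    pd (fun η => f η / g η) j θ = (pd f j θ * g θ - f θ * pd g j θ) / g θ ^ 2 := by
  have hq : DifferentiableAt ℝ (fun η => f η / g η) θ := by
    simp only [div_eq_mul_inv]
    exact hf.mul (hg.inv h0)
  have hev : f =ᶠ[𝓝 θ] fun η => f η / g η * g η := by
    filter_upwards [hg.continuousAt.eventually_ne h0] with η hη
    field_simp
  have h1 : pd f j θ = f θ / g θ * pd g j θ + pd (fun η => f η / g η) j θ * g θ := by
    rw [← pd_mul hq hg, pd, hev.fderiv_eq, pd]
  rw [h1]; field_simp; ring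

theorem pd_congr {S : Set (Target N)} (hS : IsOpen S) (hθ : θ ∈ S) (h : Set.EqOn f g S)
    (j : Fin N) : pd f j θ = pd g j θ := by
  rw [pd, pd, (h.eventuallyEq_of_mem (hS.mem_nhds hθ)).fderiv_eq]

theorem fderiv_eq_sum_pd (f : Target N → ℝ) (θ v : Target N) :
    fderiv ℝ f θ v = ∑ j, pd f j θ * v j := by
  conv_lhs => rw [pi_eq_sum_univ' v]
  simp only [map_sum, map_smul, pd, smul_eq_mul]
  exact Finset.sum_congr rfl fun j _ => mul_comm _ _

theorem hasDerivAt_comp_field {u : ℝ → Target N} {x : ℝ} (hf : DifferentiableAt ℝ f (u x))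
    (hu : DifferentiableAt ℝ u x) :
    HasDerivAt (fun y => f (u y)) (∑ j, pd f j (u x) * dx u j x) x := by
  have h := hf.hasFDerivAt.comp_hasDerivAt x hu.hasDerivAt
  rw [fderiv_eq_sum_pd] at h
  have hdx : ∀ j, deriv u x j = dx u j x := fun j => by
    rw [deriv_pi (differentiableAt_pi.1 hu)]; rfl
  simp only [hdx] at h
  exact h

end Calculus

/-! ### Dressing -/

section Dressing

variable {N : ℕ} {Λ c : ℝ} {θ : Target N}

theorem kernelMatrix_comm (i j : Fin N) : kernelMatrix N Λ c i j = kernelMatrix N Λ c j i := by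
  simp only [kernelMatrix, Matrix.of_apply, kernel]
  rw [show (node N Λ i - node N Λ j) ^ 2 = (node N Λ j - node N Λ i) ^ 2 by ring]

theorem onePlusT_eq : onePlusT N Λ c θ = 1 + kernelMatrix N Λ c * Matrix.diagonal θ := by
  ext i j
  simp [onePlusT, Matrix.one_apply, Matrix.mul_diagonal]

/-- The dressed kernel `(U K)_{ij}`. -/
def dressedKernel (N : ℕ) (Λ c : ℝ) (i j : Fin N) (θ : Target N) : ℝ :=
  dress N Λ c (fun k => kernelMatrix N Λ c k j) i θ

theorem dressedKernel_eq_mul (i j : Fin N) :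
    dressedKernel N Λ c i j θ = (dressing N Λ c θ * kernelMatrix N Λ c) i j := rfl

theorem dress_eq_mulVec (a : Fin N → ℝ) (i : Fin N) :
    dress N Λ c a i θ = (dressing N Λ c θ *ᵥ a) i := rfl

theorem onePlusT_mul_dressing (h : IsUnit (onePlusT N Λ c θ)) :
    onePlusT N Λ c θ * dressing N Λ c θ = 1 :=
  Matrix.mul_nonsing_inv _ ((Matrix.isUnit_iff_isUnit_det _).1 h)

theorem dressing_mul_onePlusT (h : IsUnit (onePlusT N Λ c θ)) :
    dressing N Λ c θ * onePlusT N Λ c θ = 1 :=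
  Matrix.nonsing_inv_mul _ ((Matrix.isUnit_iff_isUnit_det _).1 h)

theorem transpose_kernelMatrix : (kernelMatrix N Λ c)ᵀ = kernelMatrix N Λ c := by
  ext i j; exact kernelMatrix_comm j i

/-- With `Θ` the diagonal matrix of `θ`, the push-through identity `(1 + K Θ) K = K (1 + Θ K)` gives
`U K = K Uᵀ = (U K)ᵀ`. -/
theorem dressedKernel_comm (h : IsUnit (onePlusT N Λ c θ)) (i j : Fin N) :
    dressedKernel N Λ c i j θ = dressedKernel N Λ c j i θ := by
  set U := dressing N Λ c θ with hU
  set K := kernelMatrix N Λ c with hK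
  have h1 : U * (1 + K * Matrix.diagonal θ) = 1 := by
    rw [← onePlusT_eq]; exact dressing_mul_onePlusT h
  have h2 : (1 + Matrix.diagonal θ * K) * Uᵀ = 1 := by
    have := congrArg Matrix.transpose h1
    simpa [Matrix.transpose_mul, hK, transpose_kernelMatrix] using this
  have key : (U * K)ᵀ = U * K := by
    calc (U * K)ᵀ = K * Uᵀ := by rw [Matrix.transpose_mul, hK, transpose_kernelMatrix]
      _ = U * (1 + K * Matrix.diagonal θ) * (K * Uᵀ) := by rw [h1, Matrix.one_mul]
      _ = U * K * ((1 + Matrix.diagonal θ * K) * Uᵀ) := by noncomm_ring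
      _ = U * K := by rw [h2, Matrix.mul_one]
  rw [dressedKernel_eq_mul, dressedKernel_eq_mul, ← hU, ← hK]
  conv_lhs => rw [← key]
  rfl

theorem dress_eq_sub (h : IsUnit (onePlusT N Λ c θ)) (a : Fin N → ℝ) (i : Fin N) :
    dress N Λ c a i θ = a i - ∑ m, dressedKernel N Λ c i m θ * θ m * a m := by
  have h1 : dressing N Λ c θ * (1 + kernelMatrix N Λ c * Matrix.diagonal θ) = 1 := by
    rw [← onePlusT_eq]; exact dressing_mul_onePlusT h
  have h2 : dressing N Λ c θ
      = 1 - (dressing N Λ c θ * kernelMatrix N Λ c) * Matrix.diagonal θ := by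
    rw [eq_sub_iff_add_eq, ← h1]; noncomm_ring
  rw [dress_eq_mulVec, h2, Matrix.sub_mulVec, Matrix.one_mulVec, Pi.sub_apply]
  simp [Matrix.mulVec, dotProduct, Matrix.mul_diagonal, dressedKernel_eq_mul]

theorem sum_dressedKernel_mul (a : Fin N → ℝ) (i : Fin N) :
    ∑ m, dressedKernel N Λ c i m θ * a m = dress N Λ c (kernelMatrix N Λ c *ᵥ a) i θ := by
  rw [dress_eq_mulVec, Matrix.mulVec_mulVec]; rfl

theorem dress_add (a b : Fin N → ℝ) (i : Fin N) :
    dress N Λ c (fun k => a k + b k) i θ = dress N Λ c a i θ + dress N Λ c b i θ := by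
  simp [dress, mul_add, Finset.sum_add_distrib]

theorem contDiff_onePlusT (i j : Fin N) : ContDiff ℝ ∞ fun θ => onePlusT N Λ c θ i j := by
  simp only [onePlusT, Matrix.of_apply]
  fun_prop

theorem contDiff_det {A : Target N → Matrix (Fin N) (Fin N) ℝ}
    (hA : ∀ i j, ContDiff ℝ ∞ fun θ => A θ i j) : ContDiff ℝ ∞ fun θ => (A θ).det := by
  simp only [Matrix.det_apply']
  exact ContDiff.sum fun σ _ => contDiff_const.mul (contDiff_prod fun i _ => hA _ _)

/-- Cramer's rule: the entries of the inverse are polynomials in `θ` divided by the nonvanishing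
determinant. -/
theorem contDiffAt_dressing (h : IsUnit (onePlusT N Λ c θ)) (i j : Fin N) :
    ContDiffAt ℝ ∞ (fun η => dressing N Λ c η i j) θ := by
  have h0 : (onePlusT N Λ c θ).det ≠ 0 := ((Matrix.isUnit_iff_isUnit_det _).1 h).ne_zero
  simp only [dressing, Matrix.inv_def, Matrix.smul_apply, Ring.inverse_eq_inv', smul_eq_mul,
    Matrix.adjugate_apply]
  refine ((contDiff_det contDiff_onePlusT).contDiffAt.inv h0).mul
    (contDiff_det fun k l => ?_).contDiffAt
  simp only [Matrix.updateRow_apply]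
  split_ifs
  · exact contDiff_const
  · exact contDiff_onePlusT k l

theorem contDiffAt_dress (h : IsUnit (onePlusT N Λ c θ)) (a : Fin N → ℝ) (i : Fin N) :
    ContDiffAt ℝ ∞ (dress N Λ c a i) θ := by
  unfold dress
  exact ContDiffAt.sum fun j _ => (contDiffAt_dressing h i j).mul contDiffAt_const

theorem contDiffAt_dressedKernel (h : IsUnit (onePlusT N Λ c θ)) (i j : Fin N) :
    ContDiffAt ℝ ∞ (dressedKernel N Λ c i j) θ := contDiffAt_dress h _ i

theorem differentiableAt_dress (h : IsUnit (onePlusT N Λ c θ)) (a : Fin N → ℝ) (i : Fin N) :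
    DifferentiableAt ℝ (dress N Λ c a i) θ := (contDiffAt_dress h a i).differentiableAt (by simp)

theorem differentiableAt_dressedKernel (h : IsUnit (onePlusT N Λ c θ)) (i j : Fin N) :
    DifferentiableAt ℝ (dressedKernel N Λ c i j) θ := differentiableAt_dress h _ i

theorem isOpen_isUnit_onePlusT : IsOpen {θ : Target N | IsUnit (onePlusT N Λ c θ)} := by
  have : {θ : Target N | IsUnit (onePlusT N Λ c θ)} = {θ | (onePlusT N Λ c θ).det ≠ 0} := by
    ext θ; simp [Matrix.isUnit_iff_isUnit_det]
  rw [this]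
  exact isOpen_ne_fun (contDiff_det contDiff_onePlusT).continuous continuous_const

/-- Only column `j` of `1 + T` depends on `θ^j`. Differentiating `(1 + T) U a = a` therefore leaves
the `j`-th column of `K` times `(U a)_j`, and applying `U` turns that column into a column of `U K`.
-/
theorem pd_dress (h : IsUnit (onePlusT N Λ c θ)) (a : Fin N → ℝ) (i j : Fin N) :
    pd (dress N Λ c a i) j θ = -dressedKernel N Λ c i j θ * dress N Λ c a j θ := by
  have hd : ∀ l, DifferentiableAt ℝ (dress N Λ c a l) θ := differentiableAt_dress h a
  have hM : ∀ k l, DifferentiableAt ℝ (fun η => onePlusT N Λ c η k l) θ := fun k l =>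
    (contDiff_onePlusT k l).contDiffAt.differentiableAt (by simp)
  have hpM : ∀ k l, pd (fun η => onePlusT N Λ c η k l) j θ
      = if l = j then kernelMatrix N Λ c k j else 0 := by
    intro k l
    simp only [onePlusT, Matrix.of_apply]
    rw [pd_add (by fun_prop) (by fun_prop), pd_const, pd_const_mul (by fun_prop), pd_coord]
    split_ifs with hl <;> simp [hl]
  have e : ∀ k, ∑ l, onePlusT N Λ c θ k l * pd (dress N Λ c a l) j θ
      = -(kernelMatrix N Λ c k j * dress N Λ c a j θ) := by
    intro k
    have h1 : Set.EqOn (fun η => ∑ l, onePlusT N Λ c η k l * dress N Λ c a l η)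
        (fun _ => a k) {θ | IsUnit (onePlusT N Λ c θ)} := by
      intro η hη
      change (onePlusT N Λ c η *ᵥ (dressing N Λ c η *ᵥ a)) k = a k
      rw [Matrix.mulVec_mulVec, onePlusT_mul_dressing hη, Matrix.one_mulVec]
    have h2 := pd_congr isOpen_isUnit_onePlusT h h1 j
    rw [pd_const, pd_sum (F := fun l η => onePlusT N Λ c η k l * dress N Λ c a l η) _
      fun l _ => (hM k l).mul (hd l)] at h2
    simp only [pd_mul (hM k _) (hd _), hpM, Finset.sum_add_distrib, ite_mul, zero_mul,
      Finset.sum_ite_eq', Finset.mem_univ, if_true] at h2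
    linarith
  have e2 : onePlusT N Λ c θ *ᵥ (fun l => pd (dress N Λ c a l) j θ)
      = -(dress N Λ c a j θ • fun k => kernelMatrix N Λ c k j) := by
    ext k
    have := e k
    simp only [Matrix.mulVec, dotProduct, Pi.neg_apply, Pi.smul_apply, smul_eq_mul]
    rw [this]; ring
  have e3 := congrArg (fun w => (dressing N Λ c θ *ᵥ w) i) e2
  simp only [Matrix.mulVec_mulVec, dressing_mul_onePlusT h, Matrix.one_mulVec, Matrix.mulVec_neg,
    Matrix.mulVec_smul, Pi.neg_apply, Pi.smul_apply, smul_eq_mul] at e3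
  rw [e3, dressedKernel, dress_eq_mulVec _ i]; ring

theorem pd_dressedKernel (h : IsUnit (onePlusT N Λ c θ)) (i j k : Fin N) :
    pd (dressedKernel N Λ c i j) k θ
      = -dressedKernel N Λ c i k θ * dressedKernel N Λ c k j θ := pd_dress h _ i k

theorem onePlusT_zero : onePlusT N Λ c 0 = 1 := by
  simp [onePlusT_eq]

theorem dress_zero (a : Fin N → ℝ) (i : Fin N) : dress N Λ c a i 0 = a i := by
  simp [dress_eq_mulVec, dressing, onePlusT_zero]

theorem dressedKernel_zero (i j : Fin N) : dressedKernel N Λ c i j 0 = kernelMatrix N Λ c i j :=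
  dress_zero _ i

end Dressing

/-! ### Potentials -/

section Potential

variable {N : ℕ} {Λ c : ℝ} {θ : Target N}

/-- The common form `∑_i (U b)_i (q_i θ_i - a_i θ_i² / 2)` of all conserved densities and fluxes. -/
def potential (N : ℕ) (Λ c : ℝ) (b q a : Fin N → ℝ) (θ : Target N) : ℝ :=
  ∑ i, dress N Λ c b i θ * (q i * θ i - 1 / 2 * a i * θ i ^ 2)

/-- The function `B_j` with `∂_j (potential b q a) = (U b)_j B_j`. -/
def slope (N : ℕ) (Λ c : ℝ) (q a : Fin N → ℝ) (j : Fin N) (θ : Target N) : ℝ :=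
  dress N Λ c q j θ - a j * θ j
    + ∑ i, dressedKernel N Λ c j i θ * (1 / 2 * a i * θ i ^ 2)

theorem contDiffAt_potential (h : IsUnit (onePlusT N Λ c θ)) (b q a : Fin N → ℝ) :
    ContDiffAt ℝ ∞ (potential N Λ c b q a) θ := by
  unfold potential
  refine ContDiffAt.sum fun i _ => (contDiffAt_dress h b i).mul ?_
  fun_prop

theorem contDiffAt_slope (h : IsUnit (onePlusT N Λ c θ)) (q a : Fin N → ℝ) (j : Fin N) :
    ContDiffAt ℝ ∞ (slope N Λ c q a j) θ := by
  unfold slope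
  refine ((contDiffAt_dress h q j).sub (by fun_prop)).add
    (ContDiffAt.sum fun i _ => (contDiffAt_dressedKernel h j i).mul ?_)
  fun_prop

theorem differentiableAt_slope (h : IsUnit (onePlusT N Λ c θ)) (q a : Fin N → ℝ) (j : Fin N) :
    DifferentiableAt ℝ (slope N Λ c q a j) θ := (contDiffAt_slope h q a j).differentiableAt (by simp)

theorem pd_quadratic (q a : ℝ) (i j : Fin N) :
    pd (fun η => q * η i - 1 / 2 * a * η i ^ 2) j θ = if i = j then q - a * θ i else 0 := by
  simp only [sq]
  rw [pd_sub (by fun_prop) (by fun_prop), pd_const_mul (by fun_prop), pd_const_mul (by fun_prop),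
    pd_mul (by fun_prop) (by fun_prop), pd_coord]
  split_ifs <;> ring

/-- By the symmetry of the dressed kernel, every term produced by `pd_dress` carries the factor `(U
b)_j`; the rest is free of `b`. -/
theorem pd_potential (h : IsUnit (onePlusT N Λ c θ)) (b q a : Fin N → ℝ) (j : Fin N) :
    pd (potential N Λ c b q a) j θ = dress N Λ c b j θ * slope N Λ c q a j θ := by
  unfold potential
  have hd := differentiableAt_dress h b
  rw [pd_sum (F := fun i η => dress N Λ c b i η * (q i * η i - 1 / 2 * a i * η i ^ 2)) _
    fun i _ => (hd i).mul (by fun_prop)]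
  have e : ∀ i, pd (fun η => dress N Λ c b i η * (q i * η i - 1 / 2 * a i * η i ^ 2)) j θ
      = (if i = j then dress N Λ c b i θ * (q i - a i * θ i) else 0)
        + dress N Λ c b j θ * (dressedKernel N Λ c j i θ * (1 / 2 * a i * θ i ^ 2)
          - dressedKernel N Λ c j i θ * θ i * q i) := by
    intro i
    rw [pd_mul (hd i) (by fun_prop), pd_quadratic, pd_dress h, dressedKernel_comm h i j]
    split_ifs <;> ring
  simp only [e, Finset.sum_add_distrib, Finset.sum_ite_eq', Finset.mem_univ, if_true,
    ← Finset.mul_sum, Finset.sum_sub_distrib]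
  rw [slope, dress_eq_sub h q j]
  ring

theorem pd_slope (h : IsUnit (onePlusT N Λ c θ)) (q a : Fin N → ℝ) (j k : Fin N) :
    pd (slope N Λ c q a j) k θ
      = -(if j = k then a j else 0) - dressedKernel N Λ c j k θ * slope N Λ c q a k θ := by
  have hd := differentiableAt_dress h q j
  have hV := fun i => differentiableAt_dressedKernel h j i
  have hs : ∀ i, DifferentiableAt ℝ
      (fun η => dressedKernel N Λ c j i η * (0 * η i - 1 / 2 * (-a i) * η i ^ 2)) θ :=
    fun i => (hV i).mul (by fun_prop)
  -- The summand is put in the shape handled by `pd_quadratic`, with linear coefficient `0` and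
  -- quadratic coefficient `-a i`.
  have e0 : slope N Λ c q a j = fun η => dress N Λ c q j η - a j * η j
      + ∑ i, dressedKernel N Λ c j i η * (0 * η i - 1 / 2 * (-a i) * η i ^ 2) := by
    funext η
    simp only [slope]
    congr 1
    exact Finset.sum_congr rfl fun i _ => by ring
  have e1 : ∀ i, pd (fun η => dressedKernel N Λ c j i η * (0 * η i - 1 / 2 * (-a i) * η i ^ 2)) k θ
      = (if i = k then dressedKernel N Λ c j i θ * (a i * θ i) else 0)
        - dressedKernel N Λ c j k θ * (dressedKernel N Λ c k i θ * (1 / 2 * a i * θ i ^ 2)) := by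
    intro i
    rw [pd_mul (hV i) (by fun_prop), pd_quadratic, pd_dressedKernel h]
    split_ifs <;> ring
  rw [e0, pd_add (hd.fun_sub (by fun_prop)) (DifferentiableAt.fun_sum fun i _ => hs i),
    pd_sub hd (by fun_prop), pd_const_mul (by fun_prop), pd_coord, pd_dress h,
    pd_sum (F := fun i η => dressedKernel N Λ c j i η * (0 * η i - 1 / 2 * (-a i) * η i ^ 2)) _
      fun i _ => hs i]
  simp only [e1, Finset.sum_sub_distrib, Finset.sum_ite_eq', Finset.mem_univ, if_true,
    ← Finset.mul_sum, slope]
  split_ifs <;> ring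

theorem slope_zero (q a : Fin N → ℝ) (j : Fin N) : slope N Λ c q a j 0 = q j := by
  simp [slope, dress_zero]

end Potential

/-! ### Charges and Hamiltonians as potentials -/

section Charges

variable {N : ℕ} {Λ c : ℝ}

theorem chargeDeriv_succ (n : ℕ) (i : Fin N) :
    chargeDeriv N Λ (n + 1) i = node N Λ i ^ n := by
  have h : charge (n + 1) = fun k : ℝ => k ^ (n + 1) / ((n + 1 : ℕ) : ℝ) := rfl
  have h0 : ((n : ℝ) + 1) ≠ 0 := by positivity
  rw [chargeDeriv, h, deriv_div_const, deriv_pow_field]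
  push_cast
  field_simp

/-- The values at the nodes of the bare charge whose density is `chargeDensity`. -/
def bareCharge (N : ℕ) (Λ : ℝ) (n : ℕ) (i : Fin N) : ℝ :=
  Λ / N * (1 / (2 * Real.pi)) * (if n = 0 then 1 else charge n (node N Λ i))

theorem chargeDensity_eq (n : ℕ) :
    chargeDensity N Λ c n = potential N Λ c (fun _ => 1) (bareCharge N Λ n) 0 := by
  funext θ
  refine Finset.sum_congr rfl fun i _ => ?_
  simp only [density, bareCharge, momentumDeriv, Pi.zero_apply]
  ring

theorem hamiltonianDensity_eq (n : ℕ) :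
    hamiltonianDensity N Λ c n = potential N Λ c (fun _ => 1) 0 (chargeDeriv N Λ (n + 1)) := by
  funext θ
  rw [hamiltonianDensity, potential, Finset.mul_sum]
  refine Finset.sum_congr rfl fun i _ => ?_
  simp only [density, momentumDeriv, Pi.zero_apply]
  field_simp
  ring

end Charges

/-! ### The local part of the bracket -/

section Local

variable {N : ℕ} {Λ c : ℝ} {θ : Target N}

theorem pd_momentumDeriv (h : IsUnit (onePlusT N Λ c θ)) (i j : Fin N) :
    pd (momentumDeriv N Λ c i) j θ
      = -dressedKernel N Λ c i j θ * momentumDeriv N Λ c j θ := pd_dress h _ i j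

theorem differentiableAt_momentumDeriv (h : IsUnit (onePlusT N Λ c θ)) (i : Fin N) :
    DifferentiableAt ℝ (momentumDeriv N Λ c i) θ := differentiableAt_dress h _ i

theorem metric_inv_apply (hP : ∀ i, momentumDeriv N Λ c i θ ≠ 0) (i j : Fin N) :
    (metric N Λ c θ)⁻¹ i j = if i = j then (momentumDeriv N Λ c i θ ^ 2)⁻¹ else 0 := by
  have : (metric N Λ c θ)⁻¹ = Matrix.diagonal fun i => (momentumDeriv N Λ c i θ ^ 2)⁻¹ := by
    refine Matrix.inv_eq_right_inv ?_
    rw [metric, Matrix.diagonal_mul_diagonal, ← Matrix.diagonal_one]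
    congr 1; funext i
    exact mul_inv_cancel₀ (pow_ne_zero 2 (hP i))
  rw [this, Matrix.diagonal_apply]

theorem pd_metric (h : IsUnit (onePlusT N Λ c θ)) (i j k : Fin N) :
    pd (fun η => metric N Λ c η i j) k θ = if i = j then
      -2 * dressedKernel N Λ c i k θ * momentumDeriv N Λ c i θ * momentumDeriv N Λ c k θ
      else 0 := by
  simp only [metric, Matrix.diagonal_apply]
  split_ifs with hij
  · simp only [sq]
    have hd := differentiableAt_momentumDeriv h i
    rw [pd_mul hd hd, pd_momentumDeriv h]
    ring
  · exact pd_const 0 k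

/-- One formula with Kronecker deltas covers all coincidences of indices, so that the double sum in
the bracket can be collapsed termwise. -/
theorem christoffel_eq (h : IsUnit (onePlusT N Λ c θ)) (hP : ∀ i, momentumDeriv N Λ c i θ ≠ 0)
    (j i k : Fin N) :
    christoffel N Λ c j i k θ =
      (if i = k then dressedKernel N Λ c i j θ * momentumDeriv N Λ c i θ else 0)
          / momentumDeriv N Λ c j θ
        - (if j = k then dressedKernel N Λ c i k θ * momentumDeriv N Λ c i θ else 0)
          / momentumDeriv N Λ c k θ
        - (if i = j then dressedKernel N Λ c i k θ * momentumDeriv N Λ c k θ else 0)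
          / momentumDeriv N Λ c i θ := by
  have hj := hP j
  have hk := hP k
  have hi := hP i
  simp only [christoffel, metric_inv_apply hP, ite_mul, zero_mul, Finset.sum_ite_eq,
    Finset.mem_univ, if_true, pd_metric h]
  rw [dressedKernel_comm h j i]
  by_cases h1 : j = k
  · subst h1
    by_cases h2 : i = j
    · subst h2
      simp only [if_true]; field_simp; ring
    · simp only [if_true, h2, if_false]; field_simp; ring
  · by_cases h2 : i = j
    · subst h2
      simp only [h1, if_true, if_false]; field_simp; ring
    · by_cases h3 : i = k
      · subst h3
        simp only [h1, h2, if_true, if_false]; field_simp; ring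
      · simp only [h1, h2, h3, if_false]; simp

theorem christoffel_self (h : IsUnit (onePlusT N Λ c θ)) (hP : ∀ i, momentumDeriv N Λ c i θ ≠ 0)
    {i j : Fin N} (hij : i ≠ j) :
    christoffel N Λ c i i j θ
      = -dressedKernel N Λ c i j θ * momentumDeriv N Λ c j θ / momentumDeriv N Λ c i θ := by
  simp only [christoffel_eq h hP, hij, if_true, if_false]
  ring

/-- The `x`-derivative of `P'_i B_i` contains two sums over all `θ^k_x`; the Christoffel terms
cancel both. Only multiples of `θ^i_x` survive. -/
theorem local_hamVector_eq {S : Set (Target N)}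
    (hU : ∀ θ ∈ S, IsUnit (onePlusT N Λ c θ))
    (hP : ∀ θ ∈ S, ∀ i, momentumDeriv N Λ c i θ ≠ 0) (q a : Fin N → ℝ)
    {u : ℝ → Target N} (hu : IsField S u) (i : Fin N) (x : ℝ) :
    (metric N Λ c (u x))⁻¹ i i
        * deriv (varDeriv (potential N Λ c (fun _ => 1) q a) u i) x
      - (metric N Λ c (u x))⁻¹ i i * ∑ j, ∑ k, christoffel N Λ c j i k (u x) * dx u k x
          * varDeriv (potential N Λ c (fun _ => 1) q a) u j x
      = -(dx u i x / momentumDeriv N Λ c i (u x))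
        * (a i + ∑ j, dressedKernel N Λ c i j (u x) * slope N Λ c q a j (u x)) := by
  have hx := hu.2 x
  have h := hU _ hx
  have hPx := hP _ hx
  have hud : DifferentiableAt ℝ u x := hu.1.contDiffAt.differentiableAt (by simp)
  have hvar : varDeriv (potential N Λ c (fun _ => 1) q a) u i
      = fun y => momentumDeriv N Λ c i (u y) * slope N Λ c q a i (u y) := by
    funext y; exact pd_potential (hU _ (hu.2 y)) _ q a i
  have hpd : ∀ k, pd (fun η => momentumDeriv N Λ c i η * slope N Λ c q a i η) k (u x)
      = (if i = k then -(momentumDeriv N Λ c i (u x) * a i) else 0)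
        - momentumDeriv N Λ c i (u x) * (dressedKernel N Λ c i k (u x) * slope N Λ c q a k (u x))
        - dressedKernel N Λ c i k (u x) * momentumDeriv N Λ c k (u x)
          * slope N Λ c q a i (u x) := by
    intro k
    rw [pd_mul (differentiableAt_momentumDeriv h i) (differentiableAt_slope h q a i),
      pd_momentumDeriv h, pd_slope h]
    split_ifs <;> ring
  have hder : deriv (varDeriv (potential N Λ c (fun _ => 1) q a) u i) x
      = ∑ k, pd (fun η => momentumDeriv N Λ c i η * slope N Λ c q a i η) k (u x) * dx u k x := by
    rw [hvar]
    exact (hasDerivAt_comp_field (f := fun η => momentumDeriv N Λ c i η * slope N Λ c q a i η)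
      ((differentiableAt_momentumDeriv h i).mul (differentiableAt_slope h q a i)) hud).deriv
  have hvj : ∀ j, varDeriv (potential N Λ c (fun _ => 1) q a) u j x
      = momentumDeriv N Λ c j (u x) * slope N Λ c q a j (u x) := fun j => pd_potential h _ q a j
  have hchr : ∑ j, ∑ k, christoffel N Λ c j i k (u x) * dx u k x
          * varDeriv (potential N Λ c (fun _ => 1) q a) u j x
      = momentumDeriv N Λ c i (u x) * dx u i x
          * ∑ j, dressedKernel N Λ c i j (u x) * slope N Λ c q a j (u x)
        - ∑ k, momentumDeriv N Λ c i (u x)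
            * (dressedKernel N Λ c i k (u x) * slope N Λ c q a k (u x)) * dx u k x
        - ∑ k, dressedKernel N Λ c i k (u x) * momentumDeriv N Λ c k (u x)
          * slope N Λ c q a i (u x) * dx u k x := by
    have e : ∀ j k, christoffel N Λ c j i k (u x) * dx u k x
          * varDeriv (potential N Λ c (fun _ => 1) q a) u j x
        = (if i = k then momentumDeriv N Λ c i (u x) * dx u i x
            * (dressedKernel N Λ c i j (u x) * slope N Λ c q a j (u x)) else 0)
          - (if j = k then momentumDeriv N Λ c i (u x)
            * (dressedKernel N Λ c i k (u x) * slope N Λ c q a k (u x)) * dx u k x else 0)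
          - (if i = j then dressedKernel N Λ c i k (u x)
            * momentumDeriv N Λ c k (u x) * slope N Λ c q a i (u x) * dx u k x else 0) := by
      intro j k
      have hj := hPx j
      have hk := hPx k
      have hi := hPx i
      rw [christoffel_eq h hPx, hvj, sub_mul, sub_mul, sub_mul, sub_mul]
      congr 1
      · congr 1
        · split_ifs with h1
          · subst h1; field_simp
          · simp
        · split_ifs with h1
          · subst h1; field_simp
          · simp
      · split_ifs with h1
        · subst h1; field_simp
        · simp
    simp only [e, Finset.sum_sub_distrib, Finset.sum_ite_eq, Finset.mem_univ, if_true,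
      Finset.mul_sum]
    congr 1
    rw [Finset.sum_comm]
    simp
  rw [hder, hchr, metric_inv_apply hPx, if_pos rfl]
  simp only [hpd, sub_mul, Finset.sum_sub_distrib, ite_mul, zero_mul, Finset.sum_ite_eq,
      Finset.mem_univ, if_true]
  have hi := hPx i
  generalize ∑ k, momentumDeriv N Λ c i (u x)
      * (dressedKernel N Λ c i k (u x) * slope N Λ c q a k (u x)) * dx u k x = s₁
  generalize ∑ k, dressedKernel N Λ c i k (u x) * momentumDeriv N Λ c k (u x)
      * slope N Λ c q a i (u x) * dx u k x = s₂
  field_simp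
  ring

end Local

/-! ### The nonlocal part of the bracket -/

section Bracket

variable {N : ℕ} {Λ c : ℝ} {S : Set (Target N)}

/-- The primitive `-(B_m + a_m θ_m)` of the `m`-th nonlocal form of `potential 1 q a`. -/
def primitive (N : ℕ) (Λ c : ℝ) (q a : Fin N → ℝ) (m : Fin N) (θ : Target N) : ℝ :=
  -(slope N Λ c q a m θ + a m * θ m)

theorem contDiffAt_primitive {θ : Target N} (h : IsUnit (onePlusT N Λ c θ)) (q a : Fin N → ℝ)
    (m : Fin N) : ContDiffAt ℝ ∞ (primitive N Λ c q a m) θ := by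
  unfold primitive
  exact ((contDiffAt_slope h q a m).add (by fun_prop)).neg

theorem pd_primitive {θ : Target N} (h : IsUnit (onePlusT N Λ c θ)) (q a : Fin N → ℝ)
    (m j : Fin N) :
    pd (primitive N Λ c q a m) j θ = dressedKernel N Λ c m j θ * slope N Λ c q a j θ := by
  have e : primitive N Λ c q a m = fun η => (-1) * (slope N Λ c q a m η + a m * η m) := by
    funext η; simp [primitive]
  have hd := differentiableAt_slope h q a m
  rw [e, pd_const_mul (hd.fun_add (by fun_prop)), pd_add hd (by fun_prop),
    pd_const_mul (by fun_prop), pd_coord, pd_slope h]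
  split_ifs <;> ring

theorem nonlocalForm_potential {θ : Target N} (h : IsUnit (onePlusT N Λ c θ))
    (hP : ∀ i, momentumDeriv N Λ c i θ ≠ 0) (q a : Fin N → ℝ) (m j : Fin N) :
    nonlocalForm N Λ c (potential N Λ c (fun _ => 1) q a) m θ j
      = dressedKernel N Λ c m j θ * slope N Λ c q a j θ := by
  have hj := hP j
  rw [nonlocalForm, pd_potential h, dressedKernel_comm h m j]
  change dressedKernel N Λ c j m θ / momentumDeriv N Λ c j θ
    * (momentumDeriv N Λ c j θ * slope N Λ c q a j θ) = _
  field_simp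

theorem inDomain_potential (hU : ∀ θ ∈ S, IsUnit (onePlusT N Λ c θ))
    (hP : ∀ θ ∈ S, ∀ i, momentumDeriv N Λ c i θ ≠ 0) (q a : Fin N → ℝ) :
    InDomain N Λ c S (potential N Λ c (fun _ => 1) q a) :=
  ⟨fun θ hθ => (contDiffAt_potential (hU θ hθ) _ q a).contDiffWithinAt, fun m =>
    ⟨primitive N Λ c q a m, fun θ hθ => (contDiffAt_primitive (hU θ hθ) q a m).contDiffWithinAt,
      fun θ hθ j => by
        rw [nonlocalForm_potential (hU θ hθ) (hP θ hθ), pd_primitive (hU θ hθ)]⟩⟩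

theorem IsField.differentiableAt {u : ℝ → Target N} (hu : IsField S u) (x : ℝ) :
    DifferentiableAt ℝ u x := hu.1.contDiffAt.differentiableAt (by simp)

/-- The deviation of `D` from the explicit primitive enters through `U K`. The remaining terms
combine through `U a = a - V (θ a)`, with `θ a` the entrywise product, since the primitive is `-(B_m
+ a_m θ_m)`. -/
theorem hamVector_potential (hU : ∀ θ ∈ S, IsUnit (onePlusT N Λ c θ))
    (hP : ∀ θ ∈ S, ∀ i, momentumDeriv N Λ c i θ ≠ 0)
    (D : (Target N → Fin N → ℝ) →ₗ[ℝ] (Target N → ℝ)) (q a : Fin N → ℝ)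
    {u : ℝ → Target N} (hu : IsField S u) (i : Fin N) (x : ℝ) :
    hamVector N Λ c D (potential N Λ c (fun _ => 1) q a) u i x
      = -(dx u i x / momentumDeriv N Λ c i (u x))
        * dress N Λ c (fun k => a k + (kernelMatrix N Λ c *ᵥ fun m =>
            D (nonlocalForm N Λ c (potential N Λ c (fun _ => 1) q a) m) (u x)
              - primitive N Λ c q a m (u x)) k) i (u x) := by
  have hx := hU _ (hu.2 x)
  have ha := dress_eq_sub hx a i
  rw [hamVector, local_hamVector_eq hU hP q a hu, dress_add, ← sum_dressedKernel_mul, ha]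
  have haff : ∀ m, affinor N Λ c m i (u x)
      = dressedKernel N Λ c i m (u x) / momentumDeriv N Λ c i (u x) := fun m => rfl
  have e : ∀ m, dressedKernel N Λ c i m (u x)
        * (D (nonlocalForm N Λ c (potential N Λ c (fun _ => 1) q a) m) (u x)
          - primitive N Λ c q a m (u x))
      = dressedKernel N Λ c i m (u x)
          * D (nonlocalForm N Λ c (potential N Λ c (fun _ => 1) q a) m) (u x)
        + dressedKernel N Λ c i m (u x) * slope N Λ c q a m (u x)
        + dressedKernel N Λ c i m (u x) * u x m * a m := by
    intro m; rw [primitive]; ring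
  have e2 : ∀ m, affinor N Λ c m i (u x) * dx u i x
        * D (nonlocalForm N Λ c (potential N Λ c (fun _ => 1) q a) m) (u x)
      = dx u i x / momentumDeriv N Λ c i (u x) * (dressedKernel N Λ c i m (u x)
        * D (nonlocalForm N Λ c (potential N Λ c (fun _ => 1) q a) m) (u x)) := by
    intro m; rw [haff]; ring
  simp only [e, e2, Finset.sum_add_distrib, ← Finset.mul_sum]
  ring

/-- Constancy is claimed only along one field: `S` need not be connected, so the constant of
integration may differ between components. -/
theorem exists_const_of_isInverseDx (hU : ∀ θ ∈ S, IsUnit (onePlusT N Λ c θ))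
    (hP : ∀ θ ∈ S, ∀ i, momentumDeriv N Λ c i θ ≠ 0)
    {D : (Target N → Fin N → ℝ) →ₗ[ℝ] (Target N → ℝ)} (hD : IsInverseDx S D) (q a : Fin N → ℝ)
    {u : ℝ → Target N} (hu : IsField S u) (m : Fin N) (x y : ℝ) :
    D (nonlocalForm N Λ c (potential N Λ c (fun _ => 1) q a) m) (u x)
        - primitive N Λ c q a m (u x)
      = D (nonlocalForm N Λ c (potential N Λ c (fun _ => 1) q a) m) (u y)
        - primitive N Λ c q a m (u y) := by
  have h : ∀ z, HasDerivAt (fun z => D (nonlocalForm N Λ c (potential N Λ c (fun _ => 1) q a) m)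
      (u z) - primitive N Λ c q a m (u z)) 0 z := by
    intro z
    have h1 := hD.right_inv _ ((inDomain_potential hU hP q a).2 m) u hu z
    have h2 := hasDerivAt_comp_field (f := primitive N Λ c q a m)
      ((contDiffAt_primitive (hU _ (hu.2 z)) q a m).differentiableAt (by simp))
      (hu.differentiableAt z)
    refine (h1.fun_sub h2).congr_deriv (sub_eq_zero.2 ?_)
    refine Finset.sum_congr rfl fun j _ => ?_
    rw [nonlocalForm_potential (hU _ (hu.2 z)) (hP _ (hu.2 z)), pd_primitive (hU _ (hu.2 z))]
  exact is_const_of_deriv_eq_zero (fun z => (h z).differentiableAt) (fun z => (h z).deriv) x y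

/-- The factor `f (u x)` is continuous with the limit `f p` at both ends, hence bounded, and `θ_x`
is integrable. -/
theorem integrable_comp_mul_dx {u : ℝ → Target N} (hu : IsCompactField S u) {f : Target N → ℝ}
    (hf : ∀ θ ∈ S, ContinuousAt f θ) (j : Fin N) :
    Integrable fun x => f (u x) * dx u j x := by
  obtain ⟨hfield, ⟨p, hp, htop, hbot⟩, hint⟩ := hu
  have hdx : Integrable (dx u j) := by
    have : dx u j = fun x => deriv u x j := by
      funext x
      rw [deriv_pi (differentiableAt_pi.1 (hfield.differentiableAt x))]; rfl
    rw [this]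
    exact (ContinuousLinearMap.proj (R := ℝ) (φ := fun _ : Fin N => ℝ) j).integrable_comp hint
  have hcont : Continuous fun x => f (u x) := continuous_iff_continuousAt.2 fun x =>
    ContinuousAt.comp (hf _ (hfield.2 x)) hfield.1.continuous.continuousAt
  have hlim : Tendsto (fun x => f (u x)) (cocompact ℝ) (𝓝 (f p)) := by
    rw [cocompact_eq_atBot_atTop]
    exact ((hf p hp).tendsto.comp hbot).sup ((hf p hp).tendsto.comp htop)
  obtain ⟨t, ht, htC⟩ := mem_cocompact.1 (hlim.norm.eventually_lt_const (lt_add_one ‖f p‖))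
  obtain ⟨C, hC⟩ := ht.exists_bound_of_continuousOn hcont.continuousOn
  refine hdx.bdd_mul (c := max C (‖f p‖ + 1)) hcont.aestronglyMeasurable
    (Eventually.of_forall fun x => ?_)
  by_cases hx : x ∈ t
  · exact (hC x hx).trans (le_max_left _ _)
  · exact (htC hx).le.trans (le_max_right _ _)

theorem bracketVanishes_potential (hU : ∀ θ ∈ S, IsUnit (onePlusT N Λ c θ))
    (hP : ∀ θ ∈ S, ∀ i, momentumDeriv N Λ c i θ ≠ 0)
    {D : (Target N → Fin N → ℝ) →ₗ[ℝ] (Target N → ℝ)} (hD : IsInverseDx S D)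
    (q a q' a' : Fin N → ℝ) :
    BracketVanishes N Λ c S D (potential N Λ c (fun _ => 1) q a)
      (potential N Λ c (fun _ => 1) q' a') := by
  intro u hu
  set h := potential N Λ c (fun _ => 1) q' a' with hh
  -- The constants of integration, read off at `x = 0`, are absorbed into the vector to be dressed;
  -- the integrand then becomes an exact derivative whatever they are.
  set b : Fin N → ℝ := fun k => a' k + (kernelMatrix N Λ c *ᵥ fun m =>
    D (nonlocalForm N Λ c h m) (u 0) - primitive N Λ c q' a' m (u 0)) k with hb
  have hint : ∀ x, bracketIntegrand N Λ c D (potential N Λ c (fun _ => 1) q a) h u x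
      = -∑ i, pd (potential N Λ c b q a) i (u x) * dx u i x := by
    intro x
    rw [bracketIntegrand, ← Finset.sum_neg_distrib]
    refine Finset.sum_congr rfl fun i _ => ?_
    have hi := hP _ (hu.1.2 x) i
    have hconst : (fun m => D (nonlocalForm N Λ c h m) (u x) - primitive N Λ c q' a' m (u x))
        = fun m => D (nonlocalForm N Λ c h m) (u 0) - primitive N Λ c q' a' m (u 0) :=
      funext fun m => exists_const_of_isInverseDx hU hP hD q' a' hu.1 m x 0
    rw [hh, hamVector_potential hU hP D q' a' hu.1, ← hh, hconst, ← hb, varDeriv,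
      pd_potential (hU _ (hu.1.2 x)), pd_potential (hU _ (hu.1.2 x))]
    change momentumDeriv N Λ c i (u x) * _ * _ = _
    field_simp
  have hI : Integrable fun x => ∑ i, pd (potential N Λ c b q a) i (u x) * dx u i x := by
    refine integrable_finsetSum _ fun i _ => ?_
    have := integrable_comp_mul_dx hu (f := fun θ => dress N Λ c b i θ * slope N Λ c q a i θ)
      (fun θ hθ => (contDiffAt_dress (hU θ hθ) b i).continuousAt.mul
        (contDiffAt_slope (hU θ hθ) q a i).continuousAt) i
    refine this.congr (Eventually.of_forall fun x => ?_)
    simp only [pd_potential (hU _ (hu.1.2 x))]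
  have hfun : bracketIntegrand N Λ c D (potential N Λ c (fun _ => 1) q a) h u
      = fun x => -∑ i, pd (potential N Λ c b q a) i (u x) * dx u i x := funext hint
  refine ⟨hfun ▸ hI.neg, ?_⟩
  obtain ⟨p, hp, htop, hbot⟩ := hu.2.1
  have hcp := (contDiffAt_potential (hU p hp) b q a).continuousAt.tendsto
  rw [bracket, hfun, integral_neg, integral_of_hasDerivAt_of_tendsto (fun x =>
    hasDerivAt_comp_field ((contDiffAt_potential (hU _ (hu.1.2 x)) b q a).differentiableAt
      (by simp)) (hu.1.differentiableAt x)) hI (hcp.comp hbot) (hcp.comp htop)]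
  simp

end Bracket

/-! ### First integrals -/

section FirstIntegrals

variable {N : ℕ} {Λ c : ℝ} {S : Set (Target N)}

theorem isFirstIntegral_potential (hU : ∀ θ ∈ S, IsUnit (onePlusT N Λ c θ))
    (hP : ∀ θ ∈ S, ∀ i, momentumDeriv N Λ c i θ ≠ 0) (q a : Fin N → ℝ) :
    IsFirstIntegral S (velocity N Λ c) (potential N Λ c (fun _ => 1) q a) := by
  have hsm : ∀ b, ContDiffOn ℝ ∞ (potential N Λ c b q a) S := fun b θ hθ =>
    (contDiffAt_potential (hU θ hθ) b q a).contDiffWithinAt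
  -- The flux has the same slopes as the density, and `E'_j = v_j P'_j` gives `∂_j G = v_j ∂_j h`.
  refine ⟨hsm _, potential N Λ c (node N Λ) q a, hsm _, ?_⟩
  rintro O u ⟨hO, hu, huS, heq⟩ p hp
  have hup : DifferentiableAt ℝ u p :=
    (hu.contDiffAt (hO.mem_nhds hp)).differentiableAt (by simp)
  have h := hU _ (huS p hp)
  have hch : ∀ b v, fderiv ℝ (fun q' => potential N Λ c b q a (u q')) p v
      = ∑ j, dress N Λ c b j (u p) * slope N Λ c q a j (u p) * fderiv ℝ u p v j := by
    intro b v
    have := (((contDiffAt_potential h b q a).differentiableAt (by simp)).hasFDerivAt.comp p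
      hup.hasFDerivAt).fderiv
    change fderiv ℝ (fun q' => potential N Λ c b q a (u q')) p = _ at this
    rw [this, ContinuousLinearMap.comp_apply, fderiv_eq_sum_pd]
    simp only [pd_potential h]
  rw [hch, hch, ← Finset.sum_add_distrib]
  refine Finset.sum_eq_zero fun j _ => ?_
  have hj := hP _ (huS p hp) j
  have e := heq p hp j
  have e2 : velocity N Λ c j (u p) * momentumDeriv N Λ c j (u p) = dress N Λ c (node N Λ) j (u p) :=
    div_mul_cancel₀ _ hj
  rw [← e2]
  change momentumDeriv N Λ c j (u p) * _ * _ + _ = 0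
  linear_combination momentumDeriv N Λ c j (u p) * slope N Λ c q a j (u p) * e

end FirstIntegrals

/-! ### Independence -/

section Independence

variable {N : ℕ} {Λ c : ℝ} {θ : Target N}

theorem node_injective (hN : 0 < N) (hΛ : 0 < Λ) : Function.Injective (node N Λ) := by
  intro i j hij
  have hN' : (0 : ℝ) < N := by exact_mod_cast hN
  have h : (0 : ℝ) < Λ / N := by positivity
  simp only [node, add_right_inj] at hij
  have := mul_right_cancel₀ h.ne' hij
  exact Fin.ext (by exact_mod_cast add_right_cancel this)

/-- The matrix `diag(s) U` is injective. It is used with `s = P'` for the gradients of the charges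
and with `s = 1 / P'` for the velocities, reducing both to monomials at the nodes. -/
theorem linearIndependent_smul_dress (h : IsUnit (onePlusT N Λ c θ)) {s : Fin N → ℝ}
    (hs : ∀ j, s j ≠ 0) {b : Fin N → Fin N → ℝ} (hb : LinearIndependent ℝ b) :
    LinearIndependent ℝ fun n : Fin N => fun j => s j * dress N Λ c (b n) j θ := by
  let L : (Fin N → ℝ) →ₗ[ℝ] (Fin N → ℝ) :=
    (Matrix.diagonal s * dressing N Λ c θ).mulVecLin
  have hL : LinearMap.ker L = ⊥ := by
    refine LinearMap.ker_eq_bot'.2 fun v hv => ?_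
    have h1 : s * (dressing N Λ c θ *ᵥ v) = 0 := by
      rw [← hv]
      change _ = (Matrix.diagonal s * dressing N Λ c θ) *ᵥ v
      rw [← Matrix.mulVec_mulVec]
      ext j; simp [Matrix.mulVec_diagonal]
    have h2 : dressing N Λ c θ *ᵥ v = 0 := by
      ext j
      have := congrFun h1 j
      simpa [hs j] using this
    have h3 := congrArg (onePlusT N Λ c θ *ᵥ ·) h2
    simpa [Matrix.mulVec_mulVec, onePlusT_mul_dressing h] using h3
  have e : (fun n : Fin N => fun j => s j * dress N Λ c (b n) j θ) = L ∘ b := by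
    funext n j
    change _ = ((Matrix.diagonal s * dressing N Λ c θ) *ᵥ b n) j
    rw [← Matrix.mulVec_mulVec, Matrix.mulVec_diagonal, dress_eq_mulVec]
  rw [e]
  exact hb.map' L hL

theorem linearIndependent_node_pow (hN : 0 < N) (hΛ : 0 < Λ) :
    LinearIndependent ℝ fun n : Fin N => fun i : Fin N => node N Λ i ^ (n : ℕ) := by
  have h := Matrix.linearIndependent_rows_of_det_ne_zero (A := (Matrix.vandermonde (node N Λ))ᵀ)
    (by rw [Matrix.det_transpose]
        exact Matrix.det_vandermonde_ne_zero_iff.2 (node_injective hN hΛ))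
  exact h

theorem linearIndependent_bareCharge (hN : 0 < N) (hΛ : 0 < Λ) :
    LinearIndependent ℝ fun n : Fin N => bareCharge N Λ n := by
  have hN' : (N : ℝ) ≠ 0 := by exact_mod_cast hN.ne'
  have h := (linearIndependent_node_pow hN hΛ).units_smul fun n : Fin N =>
    Units.mk0 (Λ / N * (1 / (2 * Real.pi)) * (if (n : ℕ) = 0 then 1 else (1 / (n : ℕ) : ℝ))) (by
      have := Real.pi_pos
      split_ifs with h0
      · positivity
      · have : (0 : ℝ) < (n : ℕ) := by exact_mod_cast Nat.pos_of_ne_zero h0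
        positivity)
  convert h using 1
  funext n i
  simp only [bareCharge, charge, Pi.smul_apply', Units.smul_mk0, Pi.smul_apply, smul_eq_mul]
  by_cases h0 : (n : ℕ) = 0
  · simp [h0]
  · simp only [h0, if_false]; ring

end Independence

/-! ### The dressed group velocities -/

section Flows

variable {N : ℕ} {Λ c : ℝ} {S : Set (Target N)} {θ : Target N}

theorem contDiffAt_groupVelocity (h : IsUnit (onePlusT N Λ c θ))
    (hP : ∀ i, momentumDeriv N Λ c i θ ≠ 0) (n : ℕ) (i : Fin N) :
    ContDiffAt ℝ ∞ (groupVelocity N Λ c n i) θ :=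
  (contDiffAt_dress h _ i).div (contDiffAt_dress h _ i) (hP i)

theorem pd_groupVelocity (h : IsUnit (onePlusT N Λ c θ))
    (hP : ∀ i, momentumDeriv N Λ c i θ ≠ 0) (n : ℕ) (i j : Fin N) :
    pd (groupVelocity N Λ c n i) j θ
      = -dressedKernel N Λ c i j θ * momentumDeriv N Λ c j θ / momentumDeriv N Λ c i θ
        * (groupVelocity N Λ c n j θ - groupVelocity N Λ c n i θ) := by
  have hi := hP i
  have hj := hP j
  have e : groupVelocity N Λ c n i = fun η =>
    dress N Λ c (chargeDeriv N Λ (n + 1)) i η / momentumDeriv N Λ c i η := rfl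
  rw [e, pd_div (differentiableAt_dress h _ i) (differentiableAt_momentumDeriv h i) hi,
    pd_dress h, pd_momentumDeriv h]
  simp only [groupVelocity]
  field_simp
  ring

/-- Since the dressed kernel is symmetric, the right-hand side is symmetric in `j` and `k`; this is
the semi-Hamiltonian property. -/
theorem pd_christoffel_self (hS : IsOpen S) (hU : ∀ θ ∈ S, IsUnit (onePlusT N Λ c θ))
    (hP : ∀ θ ∈ S, ∀ i, momentumDeriv N Λ c i θ ≠ 0) (hθ : θ ∈ S) {i j : Fin N} (hij : i ≠ j)
    (k : Fin N) :
    pd (christoffel N Λ c i i j) k θ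
      = (dressedKernel N Λ c i k θ * dressedKernel N Λ c k j θ * momentumDeriv N Λ c j θ
          + dressedKernel N Λ c i j θ * dressedKernel N Λ c j k θ * momentumDeriv N Λ c k θ)
            / momentumDeriv N Λ c i θ
        - dressedKernel N Λ c i j θ * dressedKernel N Λ c i k θ * momentumDeriv N Λ c j θ
            * momentumDeriv N Λ c k θ / momentumDeriv N Λ c i θ ^ 2 := by
  have h := hU θ hθ
  have hi := hP θ hθ i
  have hV := differentiableAt_dressedKernel h i j
  have hp := differentiableAt_momentumDeriv h
  have e : Set.EqOn (christoffel N Λ c i i j) (fun η => (-1) * (dressedKernel N Λ c i j η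
      * momentumDeriv N Λ c j η) / momentumDeriv N Λ c i η) S := fun η hη => by
    simp only [christoffel_self (hU η hη) (hP η hη) hij]; ring
  rw [pd_congr hS hθ e, pd_div ((hV.fun_mul (hp j)).const_mul _) (hp i) hi,
    pd_const_mul (hV.fun_mul (hp j)), pd_mul hV (hp j), pd_dressedKernel h, pd_momentumDeriv h,
    pd_momentumDeriv h]
  field_simp
  ring

theorem isWNSFlow_groupVelocity (hS : IsOpen S) (hU : ∀ θ ∈ S, IsUnit (onePlusT N Λ c θ))
    (hP : ∀ θ ∈ S, ∀ i, momentumDeriv N Λ c i θ ≠ 0) (n : ℕ) :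
    IsWNSFlow N Λ c S (groupVelocity N Λ c n) := by
  refine ⟨fun i θ hθ => (contDiffAt_groupVelocity (hU θ hθ) (hP θ hθ) n i).contDiffWithinAt,
    fun θ hθ i => ?_, fun θ hθ i j hij => ?_, fun θ hθ i j k hij hjk hik => ?_⟩
  · rw [pd_groupVelocity (hU θ hθ) (hP θ hθ)]; ring
  · rw [pd_groupVelocity (hU θ hθ) (hP θ hθ), christoffel_self (hU θ hθ) (hP θ hθ) hij]
  · rw [pd_christoffel_self hS hU hP hθ hij, pd_christoffel_self hS hU hP hθ hik,
      dressedKernel_comm (hU θ hθ) k j]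
    ring

theorem dx_add_smul {u f : ℝ → Target N} {x : ℝ} (hu : DifferentiableAt ℝ u x)
    (hf : DifferentiableAt ℝ f x) (ε : ℝ) (i : Fin N) :
    dx (fun y => u y + ε • f y) i x = dx u i x + ε * dx f i x := by
  have h1 := differentiableAt_pi.1 hu i
  have h2 := differentiableAt_pi.1 hf i
  simp only [dx, Pi.add_apply, Pi.smul_apply, smul_eq_mul]
  rw [deriv_fun_add h1 (h2.const_mul ε), deriv_const_mul _ h2]

theorem differentiableAt_flowField (hU : ∀ θ ∈ S, IsUnit (onePlusT N Λ c θ))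
    (hP : ∀ θ ∈ S, ∀ i, momentumDeriv N Λ c i θ ≠ 0) (n : ℕ) {u : ℝ → Target N}
    (hu : IsField S u) (x : ℝ) : DifferentiableAt ℝ (flowField (groupVelocity N Λ c n) u) x := by
  refine differentiableAt_pi.2 fun i => ?_
  have h1 : DifferentiableAt ℝ (fun y => groupVelocity N Λ c n i (u y)) x :=
    DifferentiableAt.comp x ((contDiffAt_groupVelocity (hU _ (hu.2 x)) (hP _ (hu.2 x)) n
      i).differentiableAt (by simp)) (hu.differentiableAt x)
  have h2 : ContDiff ℝ ∞ fun y => u y i := contDiff_pi.1 hu.1 i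
  have h3 : DifferentiableAt ℝ (dx u i) x :=
    ((contDiff_infty_iff_deriv.1 h2).2.differentiable (by simp)) x
  exact h1.fun_neg.fun_mul h3

theorem dx_flowField (hU : ∀ θ ∈ S, IsUnit (onePlusT N Λ c θ))
    (hP : ∀ θ ∈ S, ∀ i, momentumDeriv N Λ c i θ ≠ 0) (n : ℕ) {u : ℝ → Target N}
    (hu : IsField S u) (i : Fin N) (x : ℝ) :
    dx (flowField (groupVelocity N Λ c n) u) i x
      = -(∑ k, pd (groupVelocity N Λ c n i) k (u x) * dx u k x) * dx u i x
        - groupVelocity N Λ c n i (u x) * deriv (dx u i) x := by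
  have h1 := hasDerivAt_comp_field ((contDiffAt_groupVelocity (hU _ (hu.2 x)) (hP _ (hu.2 x)) n
      i).differentiableAt (by simp)) (hu.differentiableAt x)
  have h2 : ContDiff ℝ ∞ fun y => u y i := contDiff_pi.1 hu.1 i
  have h3 : DifferentiableAt ℝ (dx u i) x :=
    ((contDiff_infty_iff_deriv.1 h2).2.differentiable (by simp)) x
  have h4 := (h1.fun_neg.fun_mul h3.hasDerivAt).deriv
  rw [dx]
  change deriv (fun y => -groupVelocity N Λ c n i (u y) * dx u i y) x = _
  rw [h4]; ring

theorem deriv_flowField (hU : ∀ θ ∈ S, IsUnit (onePlusT N Λ c θ))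
    (hP : ∀ θ ∈ S, ∀ i, momentumDeriv N Λ c i θ ≠ 0) (m : ℕ) {u f : ℝ → Target N}
    (hu : IsField S u) {x : ℝ} (hf : DifferentiableAt ℝ f x) (i : Fin N) :
    deriv (fun ε : ℝ => flowField (groupVelocity N Λ c m) (fun y => u y + ε • f y) x i) 0
      = -(∑ k, pd (groupVelocity N Λ c m i) k (u x) * f x k) * dx u i x
        - groupVelocity N Λ c m i (u x) * dx f i x := by
  have hx := hu.2 x
  have hline : HasDerivAt (fun ε : ℝ => u x + ε • f x) (f x) 0 := by
    simpa using ((hasDerivAt_id (0 : ℝ)).smul_const (f x)).const_add (u x)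
  have hw : HasFDerivAt (groupVelocity N Λ c m i)
      (fderiv ℝ (groupVelocity N Λ c m i) (u x)) (u x + (0 : ℝ) • f x) := by
    simpa using ((contDiffAt_groupVelocity (hU _ hx) (hP _ hx) m i).differentiableAt
      (by simp)).hasFDerivAt
  have h1 := hw.comp_hasDerivAt (0 : ℝ) hline
  rw [fderiv_eq_sum_pd] at h1
  have h2 : HasDerivAt (fun ε : ℝ => dx u i x + ε * dx f i x) (dx f i x) 0 := by
    simpa using ((hasDerivAt_id (0 : ℝ)).mul_const (dx f i x)).const_add (dx u i x)
  have h3 := h1.fun_neg.fun_mul h2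
  have e : (fun ε : ℝ => flowField (groupVelocity N Λ c m) (fun y => u y + ε • f y) x i)
      = fun ε : ℝ => -(groupVelocity N Λ c m i ∘ fun ε : ℝ => u x + ε • f x) ε
          * (dx u i x + ε * dx f i x) := by
    funext ε
    simp only [flowField, dx_add_smul (hu.differentiableAt x) hf, Function.comp]
  rw [e, h3.deriv]
  simp
  ring

theorem flowsCommute_groupVelocity (hU : ∀ θ ∈ S, IsUnit (onePlusT N Λ c θ))
    (hP : ∀ θ ∈ S, ∀ i, momentumDeriv N Λ c i θ ≠ 0) (m n : ℕ) :
    FlowsCommute S (groupVelocity N Λ c m) (groupVelocity N Λ c n) := by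
  intro u hu x i
  rw [deriv_flowField hU hP m hu (differentiableAt_flowField hU hP n hu x),
    deriv_flowField hU hP n hu (differentiableAt_flowField hU hP m hu x),
    dx_flowField hU hP n hu, dx_flowField hU hP m hu]
  -- Since `∂_k w_i` is a factor common to all flows times `w_k - w_i`, the cross terms cancel and
  -- leave that factor times `w_i w'_i - w_k w'_k`, symmetric in the two flows.
  have key : ∑ k, pd (groupVelocity N Λ c m i) k (u x)
          * flowField (groupVelocity N Λ c n) u x k
        - groupVelocity N Λ c m i (u x)
          * ∑ k, pd (groupVelocity N Λ c n i) k (u x) * dx u k x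
      = ∑ k, pd (groupVelocity N Λ c n i) k (u x)
          * flowField (groupVelocity N Λ c m) u x k
        - groupVelocity N Λ c n i (u x)
          * ∑ k, pd (groupVelocity N Λ c m i) k (u x) * dx u k x := by
    simp only [Finset.mul_sum, ← Finset.sum_sub_distrib, flowField,
      pd_groupVelocity (hU _ (hu.2 x)) (hP _ (hu.2 x))]
    exact Finset.sum_congr rfl fun k _ => by ring
  linear_combination (-dx u i x) * key

end Flows

/-! ### The kernel matrix is definite -/

section Definite

theorem integral_exp_neg_mul_cos {c : ℝ} (hc : 0 < c) (d : ℝ) :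
    IntegrableOn (fun t : ℝ => Real.exp (-c * t) * Real.cos (d * t)) (Set.Ioi 0) ∧
      ∫ t in Set.Ioi (0 : ℝ), Real.exp (-c * t) * Real.cos (d * t) = c / (c ^ 2 + d ^ 2) := by
  have hre : ((-c : ℂ) + d * Complex.I).re < 0 := by simpa using hc
  have hint := integrableOn_exp_mul_complex_Ioi hre 0
  have hval := integral_exp_mul_complex_Ioi hre 0
  have e : ∀ t : ℝ, (Complex.exp (((-c : ℂ) + d * Complex.I) * t)).re
      = Real.exp (-c * t) * Real.cos (d * t) := by
    intro t
    rw [Complex.exp_re]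
    simp
  have h1 : IntegrableOn (fun t : ℝ => (Complex.exp (((-c : ℂ) + d * Complex.I) * t)).re)
      (Set.Ioi 0) := hint.re
  have h2 := integral_re hint
  simp only [RCLike.re_to_complex] at h2
  simp only [e] at h1 h2
  refine ⟨h1, ?_⟩
  rw [h2, hval]
  have hc' : c ^ 2 + d ^ 2 ≠ 0 := by positivity
  simp [Complex.div_re, Complex.normSq_apply]
  field_simp

theorem sum_mul_cos_sub {N : ℕ} (x k : Fin N → ℝ) (t : ℝ) :
    ∑ i, ∑ j, x i * x j * Real.cos ((k i - k j) * t)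
      = (∑ j, x j * Real.cos (k j * t)) ^ 2 + (∑ j, x j * Real.sin (k j * t)) ^ 2 := by
  simp only [sq, Finset.sum_mul_sum, ← Finset.sum_add_distrib, sub_mul, Real.cos_sub]
  exact Finset.sum_congr rfl fun i _ => Finset.sum_congr rfl fun j _ => by ring

/-- The quadratic form equals `∫_0^∞ e^{-ct} |∑_j x_j e^{i k_j t}|² dt`. If it vanishes, so does the
continuous nonnegative integrand at every `t > 0`. -/
theorem sum_mul_exp_eq_zero {N : ℕ} {c : ℝ} (hc : 0 < c) {x k : Fin N → ℝ}
    (h : ∑ i, ∑ j, x i * x j * (c / (c ^ 2 + (k i - k j) ^ 2)) = 0) {t : ℝ} (ht : 0 < t) :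
    ∑ j, (x j : ℂ) * Complex.exp (k j * t * Complex.I) = 0 := by
  set f : ℝ → ℝ := fun t => Real.exp (-c * t) *
    ((∑ j, x j * Real.cos (k j * t)) ^ 2 + (∑ j, x j * Real.sin (k j * t)) ^ 2) with hf
  have hf' : f = fun t => ∑ i, ∑ j, x i * x j *
      (Real.exp (-c * t) * Real.cos ((k i - k j) * t)) := by
    funext t
    simp only [hf, ← sum_mul_cos_sub, Finset.mul_sum]
    exact Finset.sum_congr rfl fun i _ => Finset.sum_congr rfl fun j _ => by ring
  have hterm : ∀ i j, IntegrableOn (fun t : ℝ => x i * x j *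
      (Real.exp (-c * t) * Real.cos ((k i - k j) * t))) (Set.Ioi 0) := fun i j =>
    (integral_exp_neg_mul_cos hc _).1.const_mul _
  have hint : IntegrableOn f (Set.Ioi 0) := by
    rw [hf']
    exact integrable_finsetSum _ fun i _ => integrable_finsetSum _ fun j _ => hterm i j
  have hzero : ∫ t in Set.Ioi (0 : ℝ), f t = 0 := by
    rw [hf', integral_finsetSum _ fun i _ => integrable_finsetSum _ fun j _ => hterm i j]
    refine Eq.trans ?_ h
    refine Finset.sum_congr rfl fun i _ => ?_
    rw [integral_finsetSum _ fun j _ => hterm i j]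
    refine Finset.sum_congr rfl fun j _ => ?_
    rw [integral_const_mul, (integral_exp_neg_mul_cos hc _).2]
  have hnn : ∀ t, 0 ≤ f t := fun t => by positivity
  have hae : f =ᵐ[volume.restrict (Set.Ioi 0)] 0 :=
    (integral_eq_zero_iff_of_nonneg hnn hint).1 hzero
  have hcont : Continuous f := by fun_prop
  have hft : f t = 0 :=
    Measure.eqOn_open_of_ae_eq hae isOpen_Ioi hcont.continuousOn continuousOn_const ht
  have hsum := (mul_eq_zero.1 hft).resolve_left (Real.exp_pos _).ne'
  rw [add_eq_zero_iff_of_nonneg (sq_nonneg _) (sq_nonneg _)] at hsum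
  have h1 := pow_eq_zero_iff (two_ne_zero) |>.1 hsum.1
  have h2 := pow_eq_zero_iff (two_ne_zero) |>.1 hsum.2
  have e : ∑ j, (x j : ℂ) * Complex.exp (k j * t * Complex.I)
      = ((∑ j, x j * Real.cos (k j * t) : ℝ) : ℂ)
        + ((∑ j, x j * Real.sin (k j * t) : ℝ) : ℂ) * Complex.I := by
    push_cast
    rw [Finset.sum_mul, ← Finset.sum_add_distrib]
    refine Finset.sum_congr rfl fun j _ => ?_
    rw [Complex.exp_mul_I]; ring
  rw [e, h1, h2]; simp

theorem abs_node_le {N : ℕ} {Λ : ℝ} (hΛ : 0 < Λ) (i : Fin N) :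
    -(Λ / 2) ≤ node N Λ i ∧ node N Λ i ≤ Λ / 2 := by
  have hN : (0 : ℝ) < N := by exact_mod_cast i.pos
  have hi : ((i : ℕ) + 1 : ℝ) ≤ N := by exact_mod_cast i.2
  have h1 : ((i : ℕ) + 1 : ℝ) * (Λ / N) ≤ N * (Λ / N) := by gcongr
  have h2 : (N : ℝ) * (Λ / N) = Λ := by field_simp
  have h3 : 0 ≤ ((i : ℕ) + 1 : ℝ) * (Λ / N) := by positivity
  simp only [node]
  constructor <;> linarith

theorem kernelMatrix_mulVec_eq_zero {N : ℕ} {Λ c : ℝ} (hΛ : 0 < Λ) (hc : 0 < c)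
    {x : Fin N → ℝ} (hx : kernelMatrix N Λ c *ᵥ x = 0) : x = 0 := by
  have hN : ∀ _ : Fin N, (0 : ℝ) < N := fun i => by exact_mod_cast i.pos
  have hpi := Real.pi_pos
  have hq : ∑ i, ∑ j, x i * x j * (c / (c ^ 2 + (node N Λ i - node N Λ j) ^ 2)) = 0 := by
    refine Finset.sum_eq_zero fun i _ => ?_
    have h1 := congrFun hx i
    have h2 : ∑ j, x i * x j * (c / (c ^ 2 + (node N Λ i - node N Λ j) ^ 2))
        = -(Real.pi * N / Λ * x i) * (kernelMatrix N Λ c *ᵥ x) i := by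
      simp only [Matrix.mulVec, dotProduct, Finset.mul_sum]
      refine Finset.sum_congr rfl fun j _ => ?_
      have := hN i
      have hd : c ^ 2 + (node N Λ i - node N Λ j) ^ 2 ≠ 0 := by positivity
      simp only [kernelMatrix, kernel, Matrix.of_apply]
      field_simp
    rw [h2, h1]; simp
  -- With this step the phases `k_j τ` lie in `[-π/2, π/2]`, so the numbers `e^{i k_j τ}` are
  -- distinct and sampling at multiples of `τ` gives a Vandermonde system.
  set τ : ℝ := Real.pi / Λ with hτ
  have hτ0 : 0 < τ := by positivity
  set z : Fin N → ℂ := fun j => Complex.exp (node N Λ j * τ * Complex.I) with hz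
  have hzinj : Function.Injective z := by
    intro i j hij
    have him : ∀ i, -(Real.pi / 2) ≤ node N Λ i * τ ∧ node N Λ i * τ ≤ Real.pi / 2 := by
      intro i
      have e : Real.pi / 2 = Λ / 2 * τ := by rw [hτ]; field_simp
      obtain ⟨h1, h2⟩ := abs_node_le hΛ i
      rw [e, ← neg_mul]
      exact ⟨mul_le_mul_of_nonneg_right h1 hτ0.le, mul_le_mul_of_nonneg_right h2 hτ0.le⟩
    have e := Complex.exp_inj_of_neg_pi_lt_of_le_pi (x := node N Λ i * τ * Complex.I)
      (y := node N Λ j * τ * Complex.I)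
      (by simp; linarith [(him i).1]) (by simp; linarith [(him i).2])
      (by simp; linarith [(him j).1]) (by simp; linarith [(him j).2]) hij
    have e2 : node N Λ i * τ = node N Λ j * τ := by
      have := congrArg Complex.im e
      simpa using this
    exact node_injective i.pos hΛ (mul_right_cancel₀ hτ0.ne' e2)
  -- The samples are taken at `t = (s + 1) τ` because `t = 0` is not available; the extra nonzero
  -- factor `z j` goes into the unknowns.
  have hpow : ∀ s : Fin N, ∑ j, ((x j : ℂ) * z j) * z j ^ (s : ℕ) = 0 := by
    intro s
    have h := sum_mul_exp_eq_zero hc hq (t := ((s : ℕ) + 1 : ℝ) * τ) (by positivity)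
    rw [← h]
    refine Finset.sum_congr rfl fun j _ => ?_
    rw [mul_assoc, ← pow_succ', hz, ← Complex.exp_nat_mul]
    congr 2
    push_cast
    ring
  have hzero := Matrix.eq_zero_of_forall_pow_sum_mul_pow_eq_zero hzinj hpow
  ext j
  have := congrFun hzero j
  simpa [hz, Complex.exp_ne_zero] using this

theorem isUnit_kernelMatrix {N : ℕ} {Λ c : ℝ} (hΛ : 0 < Λ) (hc : 0 < c) :
    IsUnit (kernelMatrix N Λ c) := by
  rw [Matrix.isUnit_iff_isUnit_det, isUnit_iff_ne_zero]
  intro h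
  obtain ⟨v, hv, hv0⟩ := Matrix.exists_mulVec_eq_zero_iff.2 h
  exact hv (kernelMatrix_mulVec_eq_zero hΛ hc hv0)

theorem kernelMatrix_ne_zero {N : ℕ} {Λ c : ℝ} (hΛ : 0 < Λ) (hc : 0 < c) (i j : Fin N) :
    kernelMatrix N Λ c i j ≠ 0 := by
  have hN : (0 : ℝ) < N := by exact_mod_cast i.pos
  have hpi := Real.pi_pos
  have : kernelMatrix N Λ c i j = -(Λ / N * (1 / (2 * Real.pi)
    * (2 * c / (c ^ 2 + (node N Λ i - node N Λ j) ^ 2)))) := by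
    simp [kernelMatrix, kernel]
  rw [this]
  exact neg_ne_zero.2 (by positivity)

end Definite

/-! ### A realization of the inverse of the total derivative -/

/-- Enlarge `W` to a complement of the kernel and invert `d` there. With `d` the differential, this
fixes the primitives in `W` in advance; disjointness from the constants of integration makes the
choice consistent. -/
theorem exists_section_of_disjoint_ker {k E F : Type*} [Field k] [AddCommGroup E] [Module k E]
    [AddCommGroup F] [Module k F] (d : E →ₗ[k] F) {W : Submodule k E}
    (hW : Disjoint W (LinearMap.ker d)) :
    ∃ s : F →ₗ[k] E, (∀ w ∈ W, s (d w) = w) ∧ ∀ e, d (s (d e)) = d e := by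
  obtain ⟨C, hWC, hC⟩ := hW.exists_isCompl
  have hinj : LinearMap.ker (d ∘ₗ C.subtype) = ⊥ := by
    refine LinearMap.ker_eq_bot'.2 fun w hw => ?_
    have : (w : E) ∈ C ⊓ LinearMap.ker d := ⟨w.2, hw⟩
    rw [hC.inf_eq_bot] at this
    exact Subtype.ext this
  obtain ⟨g, hg⟩ := (d ∘ₗ C.subtype).exists_leftInverse_of_injective hinj
  have hgC : ∀ w (hw : w ∈ C), (g (d w) : E) = w := fun w hw =>
    congrArg Subtype.val (LinearMap.congr_fun hg ⟨w, hw⟩)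
  refine ⟨C.subtype ∘ₗ g, fun w hw => hgC w (hWC hw), fun e => ?_⟩
  have he : e ∈ C ⊔ LinearMap.ker d := by rw [hC.sup_eq_top]; trivial
  obtain ⟨w, hw, z, hz, rfl⟩ := Submodule.mem_sup.1 he
  have hz0 : d z = 0 := hz
  simp only [map_add, hz0, add_zero, LinearMap.comp_apply, Submodule.subtype_apply, hgC w hw]

/-! ### Linear relations between the nonlocal forms -/

section Rigidity

variable {N : ℕ} {Λ c : ℝ} {S : Set (Target N)}

theorem primitive_eq {θ : Target N} (q a : Fin N → ℝ) (m : Fin N) :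
    primitive N Λ c q a m θ = -(dress N Λ c q m θ
      + ∑ i, dressedKernel N Λ c m i θ * (1 / 2 * a i * θ i ^ 2)) := by
  rw [primitive, slope]; ring

/-- The sum is `tr(U Mᵀ)`. As `K M` is antisymmetric, so is `M K⁻¹`, and the sum equals `-tr((U K)(M
K⁻¹))`, the trace of a symmetric times an antisymmetric matrix. -/
theorem sum_dress_eq_zero {θ : Target N} (hΛ : 0 < Λ) (hc : 0 < c)
    (h : IsUnit (onePlusT N Λ c θ)) {M : Matrix (Fin N) (Fin N) ℝ}
    (hM : kernelMatrix N Λ c * M + (kernelMatrix N Λ c * M)ᵀ = 0) :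
    ∑ m, dress N Λ c (M m) m θ = 0 := by
  set K := kernelMatrix N Λ c with hK
  set U := dressing N Λ c θ with hU
  have hKdet : IsUnit K.det := (Matrix.isUnit_iff_isUnit_det _).1 (isUnit_kernelMatrix hΛ hc)
  have hKt : Kᵀ = K := transpose_kernelMatrix
  have hV : (U * K)ᵀ = U * K := by
    ext i j; exact dressedKernel_comm h j i
  have hMt : Mᵀ = -(K * M * K⁻¹) := by
    have h1 : Mᵀ * K = -(K * M) := by
      rw [Matrix.transpose_mul, hKt] at hM
      exact (neg_eq_of_add_eq_zero_right hM).symm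
    rw [← neg_mul, ← h1, Matrix.mul_assoc, Matrix.mul_nonsing_inv _ hKdet, Matrix.mul_one]
  have htr : ∑ m, dress N Λ c (M m) m θ = (U * Mᵀ).trace := rfl
  have h1 : (U * Mᵀ).trace = -((U * K) * (M * K⁻¹)).trace := by
    rw [hMt, Matrix.mul_neg, Matrix.trace_neg]
    congr 2; noncomm_ring
  have h2 : ((U * K) * (M * K⁻¹)).trace = (U * Mᵀ).trace := by
    rw [← Matrix.trace_transpose, Matrix.transpose_mul, Matrix.transpose_mul,
      Matrix.trace_mul_comm, hV, Matrix.transpose_nonsing_inv, hKt, ← Matrix.mul_assoc,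
      Matrix.mul_assoc U, Matrix.mul_nonsing_inv _ hKdet, Matrix.mul_one]
  rw [htr]
  linarith

/-- The relation and its derivatives, evaluated at `θ = 0` where `V = K`, force `L = 0` and `K M`
antisymmetric. The conclusion then holds algebraically at each `θ`, so connectedness of `S` plays no
role. -/
theorem sum_primitive_eq_zero (hΛ : 0 < Λ) (hc : 0 < c) (hS : IsOpen S) (hS0 : 0 ∈ S)
    (hU : ∀ θ ∈ S, IsUnit (onePlusT N Λ c θ)) {M L : Matrix (Fin N) (Fin N) ℝ}
    (h : ∀ θ ∈ S, ∀ j, ∑ m, pd (primitive N Λ c (M m) (L m) m) j θ = 0) {θ : Target N}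
    (hθ : θ ∈ S) : ∑ m, primitive N Λ c (M m) (L m) m θ = 0 := by
  have h1 : ∀ j, ∀ η ∈ S, ∑ m, dressedKernel N Λ c j m η * slope N Λ c (M m) (L m) j η = 0 := by
    intro j η hη
    rw [← h η hη j]
    exact Finset.sum_congr rfl fun m _ => by
      rw [pd_primitive (hU η hη), dressedKernel_comm (hU η hη)]
  have h2 : ∀ η ∈ S, ∀ j k, (if j = k then ∑ m, dressedKernel N Λ c j m η * L m j else 0)
      + dressedKernel N Λ c j k η * (∑ m, dressedKernel N Λ c j m η * slope N Λ c (M m) (L m) k η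
        + ∑ m, dressedKernel N Λ c k m η * slope N Λ c (M m) (L m) j η) = 0 := by
    intro η hη j k
    have hη' := hU η hη
    have hd := differentiableAt_dressedKernel hη' j
    have hs := fun m => differentiableAt_slope hη' (M m) (L m) j
    have e := pd_congr hS hη (h1 j) k
    rw [pd_const, pd_sum (F := fun m η => dressedKernel N Λ c j m η *
      slope N Λ c (M m) (L m) j η) _ fun m _ => (hd m).mul (hs m)] at e
    have e2 : ∀ m, pd (fun η => dressedKernel N Λ c j m η * slope N Λ c (M m) (L m) j η) k η
        = -((if j = k then dressedKernel N Λ c j m η * L m j else 0)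
          + dressedKernel N Λ c j k η
            * (dressedKernel N Λ c j m η * slope N Λ c (M m) (L m) k η
              + dressedKernel N Λ c k m η * slope N Λ c (M m) (L m) j η)) := by
      intro m
      rw [pd_mul (hd m) (hs m), pd_slope hη', pd_dressedKernel hη']
      split_ifs <;> ring
    simp only [e2, Finset.sum_neg_distrib, Finset.sum_add_distrib, ← Finset.mul_sum] at e
    rw [neg_eq_zero] at e
    refine Eq.trans ?_ e
    congr 1
    split_ifs <;> simp
  -- On the diagonal `k = j` the bracket in `h2` is twice the expression in `h1`, hence zero.
  have h3 : ∀ j, ∀ η ∈ S, ∑ m, dressedKernel N Λ c j m η * L m j = 0 := by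
    intro j η hη
    have := h2 η hη j j
    simpa [h1 j η hη] using this
  have h4 : ∀ η ∈ S, ∀ j k, dressedKernel N Λ c j k η
      * ∑ m, dressedKernel N Λ c k m η * L m j = 0 := by
    intro η hη j k
    have hη' := hU η hη
    have hd := differentiableAt_dressedKernel hη' j
    have e := pd_congr hS hη (h3 j) k
    rw [pd_const, pd_sum (F := fun m η => dressedKernel N Λ c j m η * L m j) _
      fun m _ => (hd m).mul_const _] at e
    rw [Finset.mul_sum, ← neg_eq_zero, ← Finset.sum_neg_distrib, ← e]
    refine Finset.sum_congr rfl fun m _ => ?_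
    rw [pd_mul (hd m) (differentiableAt_const _), pd_const, pd_dressedKernel hη']
    ring
  -- At `0` the factor in front is an entry of `K`, which is nonzero, and `K` is injective on each
  -- column of `L`.
  have hL : L = 0 := by
    have : ∀ j, (fun m => L m j) = 0 := fun j => by
      refine kernelMatrix_mulVec_eq_zero hΛ hc (funext fun k => ?_)
      have e := h4 0 hS0 j k
      simp only [dressedKernel_zero] at e
      exact (mul_eq_zero.1 e).resolve_left (kernelMatrix_ne_zero hΛ hc j k)
    ext m j
    exact congrFun (this j) m
  -- With `L = 0`, the slopes at `0` in `h2` are the entries of `M`.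
  have hM : kernelMatrix N Λ c * M + (kernelMatrix N Λ c * M)ᵀ = 0 := by
    ext j k
    have e := h2 0 hS0 j k
    simp only [dressedKernel_zero, slope_zero, hL, Matrix.zero_apply, mul_zero,
      Finset.sum_const_zero, ite_self, zero_add] at e
    exact (mul_eq_zero.1 e).resolve_left (kernelMatrix_ne_zero hΛ hc j k)
  have hz : ∀ m, primitive N Λ c (M m) (L m) m θ = -dress N Λ c (M m) m θ := by
    intro m
    simp [primitive_eq, hL]
  simp only [hz, Finset.sum_neg_distrib, sum_dress_eq_zero hΛ hc (hU θ hθ) hM, neg_zero]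

end Rigidity

/-! ### Construction of the normalized inverse -/

section Inverse

variable {N : ℕ} {Λ c : ℝ} {S : Set (Target N)}

/-- Smooth functions on `S`, extended by zero. -/
def smoothOn (S : Set (Target N)) : Submodule ℝ (Target N → ℝ) where
  carrier := {F | ContDiffOn ℝ ∞ F S ∧ ∀ θ, θ ∉ S → F θ = 0}
  add_mem' hF hG := ⟨hF.1.add hG.1, fun θ hθ => by simp [hF.2 θ hθ, hG.2 θ hθ]⟩
  zero_mem' := ⟨contDiffOn_const, fun _ _ => rfl⟩
  smul_mem' r _ hF := ⟨contDiffOn_const.smul hF.1, fun θ hθ => by simp [hF.2 θ hθ]⟩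

theorem smoothOn.differentiableAt (hS : IsOpen S) (F : smoothOn S) {θ : Target N} (hθ : θ ∈ S) :
    DifferentiableAt ℝ F.1 θ :=
  (F.2.1.contDiffAt (hS.mem_nhds hθ)).differentiableAt (by simp)

/-- Restriction of families of coefficients to `S`, extended by zero. -/
def restrictForm (S : Set (Target N)) : (Target N → Fin N → ℝ) →ₗ[ℝ] (Target N → Fin N → ℝ) where
  toFun σ := S.indicator σ
  map_add' _ _ := Set.indicator_add _ _ _
  map_smul' r σ := Set.indicator_const_smul S r σ

theorem restrictForm_apply (σ : Target N → Fin N → ℝ) : restrictForm S σ = S.indicator σ := rfl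

/-- The differential on smooth functions on `S`. -/
def differential (hS : IsOpen S) : smoothOn S →ₗ[ℝ] (Target N → Fin N → ℝ) where
  toFun F := S.indicator fun θ j => pd F.1 j θ
  map_add' F G := by
    funext θ j
    by_cases hθ : θ ∈ S
    · simp only [Pi.add_apply, Set.indicator_of_mem hθ]
      exact pd_add (smoothOn.differentiableAt hS F hθ) (smoothOn.differentiableAt hS G hθ) j
    · simp [hθ]
  map_smul' r F := by
    funext θ j
    by_cases hθ : θ ∈ S
    · simp only [Pi.smul_apply, Set.indicator_of_mem hθ]
      exact pd_const_mul (smoothOn.differentiableAt hS F hθ) r j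
    · simp [hθ]

theorem differential_apply (hS : IsOpen S) (F : smoothOn S) :
    differential hS F = S.indicator fun θ j => pd F.1 j θ := rfl

/-- The combinations `∑_m primitive (M m) (L m) m` as smooth functions on `S`. -/
def primitiveMap (hU : ∀ θ ∈ S, IsUnit (onePlusT N Λ c θ)) :
    (Matrix (Fin N) (Fin N) ℝ × Matrix (Fin N) (Fin N) ℝ) →ₗ[ℝ] smoothOn S where
  toFun p := ⟨S.indicator fun θ => ∑ m, primitive N Λ c (p.1 m) (p.2 m) m θ,
    ContDiffOn.congr (fun θ hθ => (ContDiffAt.sum fun m _ => contDiffAt_primitive (hU θ hθ) (p.1 m)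
      (p.2 m) m).contDiffWithinAt) fun θ hθ => Set.indicator_of_mem hθ _,
    fun θ hθ => Set.indicator_of_notMem hθ _⟩
  map_add' p p' := by
    refine Subtype.ext (funext fun θ => ?_)
    by_cases hθ : θ ∈ S
    · simp only [Submodule.coe_add, Pi.add_apply, Set.indicator_of_mem hθ,
        ← Finset.sum_add_distrib]
      refine Finset.sum_congr rfl fun m _ => ?_
      simp only [primitive_eq, Prod.fst_add, Prod.snd_add, dress, Matrix.add_apply, mul_add, add_mul,
        Finset.sum_add_distrib]
      ring
    · simp [hθ]
  map_smul' r p := by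
    refine Subtype.ext (funext fun θ => ?_)
    by_cases hθ : θ ∈ S
    · simp only [Submodule.coe_smul, Pi.smul_apply, Set.indicator_of_mem hθ, smul_eq_mul,
        Finset.mul_sum, RingHom.id_apply]
      refine Finset.sum_congr rfl fun m _ => ?_
      simp only [primitive_eq, dress, Prod.smul_fst, Prod.smul_snd, Matrix.smul_apply,
        smul_eq_mul, mul_neg, mul_add, Finset.mul_sum]
      congr 2 <;> exact Finset.sum_congr rfl fun i _ => by ring
    · simp [hθ]

theorem primitiveMap_apply (hU : ∀ θ ∈ S, IsUnit (onePlusT N Λ c θ))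
    (M L : Matrix (Fin N) (Fin N) ℝ) : (primitiveMap (c := c) hU (M, L)).1
      = S.indicator fun θ => ∑ m, primitive N Λ c (M m) (L m) m θ := rfl

/-- The span of the primitives meets the kernel of the differential trivially by
`sum_primitive_eq_zero`, so a linear section of the differential can be chosen to return exactly
these primitives. -/
theorem exists_isInverseDx_primitive (hΛ : 0 < Λ) (hc : 0 < c) (hS : IsOpen S) (hS0 : 0 ∈ S)
    (hU : ∀ θ ∈ S, IsUnit (onePlusT N Λ c θ))
    (hP : ∀ θ ∈ S, ∀ i, momentumDeriv N Λ c i θ ≠ 0) :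
    ∃ D : (Target N → Fin N → ℝ) →ₗ[ℝ] (Target N → ℝ), IsInverseDx S D ∧
      ∀ q a m, ∀ θ ∈ S, D (nonlocalForm N Λ c (potential N Λ c (fun _ => 1) q a) m) θ
        = primitive N Λ c q a m θ := by
  have hdisj : Disjoint (LinearMap.range (primitiveMap (c := c) hU))
      (LinearMap.ker (differential hS)) := by
    rw [Submodule.disjoint_def]
    rintro _ ⟨⟨M, L⟩, rfl⟩ hker
    have hpd : ∀ θ ∈ S, ∀ j, ∑ m, pd (primitive N Λ c (M m) (L m) m) j θ = 0 := by
      intro θ hθ j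
      have h1 : pd (primitiveMap (c := c) hU (M, L)).1 j θ = 0 := by
        have := congrFun (congrFun (LinearMap.mem_ker.1 hker) θ) j
        simpa [differential_apply, hθ] using this
      rw [← pd_sum _ fun m _ => (contDiffAt_primitive (hU θ hθ) (M m) (L m) m).differentiableAt
        (by simp), ← h1, primitiveMap_apply]
      exact pd_congr hS hθ Set.eqOn_indicator.symm j
    refine Subtype.ext (funext fun θ => ?_)
    by_cases hθ : θ ∈ S
    · rw [primitiveMap_apply, Set.indicator_of_mem hθ]
      exact sum_primitive_eq_zero hΛ hc hS hS0 hU hpd hθ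
    · rw [primitiveMap_apply, Set.indicator_of_notMem hθ]
      rfl
  obtain ⟨s, hsW, hs⟩ := exists_section_of_disjoint_ker (differential hS) hdisj
  have hform : ∀ (σ : Target N → Fin N → ℝ) (F : smoothOn S),
      (∀ θ ∈ S, ∀ j, σ θ j = pd F.1 j θ) → restrictForm S σ = differential hS F := by
    intro σ F hσ
    rw [restrictForm_apply, differential_apply]
    exact Set.indicator_congr fun θ hθ => funext fun j => hσ θ hθ j
  refine ⟨(smoothOn S).subtype ∘ₗ s ∘ₗ restrictForm S, ⟨fun σ σ' h => ?_, ?_⟩, ?_⟩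
  · have : restrictForm S σ = restrictForm S σ' := by
      rw [restrictForm_apply, restrictForm_apply]
      exact Set.indicator_congr h
    simp only [LinearMap.comp_apply, this]
    exact fun _ _ => rfl
  · rintro σ ⟨F, hF, hσ⟩ u hu x
    let F' : smoothOn S := ⟨S.indicator F, hF.congr fun θ hθ => Set.indicator_of_mem hθ _,
      fun θ hθ => Set.indicator_of_notMem hθ _⟩
    have h1 : restrictForm S σ = differential hS F' := hform σ F' fun θ hθ j => by
      rw [hσ θ hθ j]
      exact pd_congr hS hθ Set.eqOn_indicator.symm j
    have h2 := hs F'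
    rw [← h1] at h2
    have h3 : ∀ j, σ (u x) j = pd (s (restrictForm S σ)).1 j (u x) := fun j => by
      have := congrFun (congrFun h2 (u x)) j
      simpa [differential_apply, restrictForm_apply, hu.2 x] using this.symm
    simp only [h3]
    exact hasDerivAt_comp_field (smoothOn.differentiableAt hS _ (hu.2 x))
      (hu.differentiableAt x)
  · intro q a m θ hθ
    -- Matrices whose only nonzero row is row `m` single out one primitive from the sum.
    set F := primitiveMap (c := c) hU (Matrix.of (Pi.single m q), Matrix.of (Pi.single m a)) with hF
    have hval : ∀ η ∈ S, F.1 η = primitive N Λ c q a m η := by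
      intro η hη
      rw [hF, primitiveMap_apply, Set.indicator_of_mem hη]
      have hrow : ∀ (r : Fin N → ℝ) (l : Fin N), Matrix.of (Pi.single m r) l
          = if l = m then r else 0 := fun r l => by
        change (Pi.single m r : Fin N → Fin N → ℝ) l = _
        rw [Pi.single_apply]
      have hterm : ∀ l, primitive N Λ c (Matrix.of (Pi.single m q) l)
          (Matrix.of (Pi.single m a) l) l η = if l = m then primitive N Λ c q a m η else 0 := by
        intro l
        rw [hrow, hrow]
        split_ifs with hl
        · rw [hl]
        · simp [primitive_eq, dress]
      refine (Finset.sum_congr rfl fun l _ => hterm l).trans ?_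
      simp
    have h1 : restrictForm S (nonlocalForm N Λ c (potential N Λ c (fun _ => 1) q a) m)
        = differential hS F := hform _ F fun η hη j => by
      rw [nonlocalForm_potential (hU η hη) (hP η hη), ← pd_primitive (hU η hη)]
      exact pd_congr hS hη (fun ξ hξ => (hval ξ hξ).symm) j
    simp only [LinearMap.comp_apply, h1, hsW F ⟨_, rfl⟩]
    exact hval θ hθ

end Inverse

/-! ### Hamiltonian vectors for the normalized inverse, and independence -/

section Algebra

variable {N : ℕ} {Λ c : ℝ} {S : Set (Target N)}

theorem hamVector_potential_of_primitive (hU : ∀ θ ∈ S, IsUnit (onePlusT N Λ c θ))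
    (hP : ∀ θ ∈ S, ∀ i, momentumDeriv N Λ c i θ ≠ 0)
    {D : (Target N → Fin N → ℝ) →ₗ[ℝ] (Target N → ℝ)} {q a : Fin N → ℝ}
    (hD : ∀ m, ∀ θ ∈ S, D (nonlocalForm N Λ c (potential N Λ c (fun _ => 1) q a) m) θ
        = primitive N Λ c q a m θ)
    {u : ℝ → Target N} (hu : IsField S u) (i : Fin N) (x : ℝ) :
    hamVector N Λ c D (potential N Λ c (fun _ => 1) q a) u i x
      = -(dress N Λ c a i (u x) / momentumDeriv N Λ c i (u x)) * dx u i x := by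
  have e : (fun m => D (nonlocalForm N Λ c (potential N Λ c (fun _ => 1) q a) m) (u x)
      - primitive N Λ c q a m (u x)) = 0 := funext fun m => sub_eq_zero.2 (hD m _ (hu.2 x))
  rw [hamVector_potential hU hP D q a hu, e]
  simp only [Matrix.mulVec_zero, Pi.zero_apply, add_zero]
  ring

/-- For `a = 0` the slope is just `U q`, so the gradient is `P'_j (U q)_j`. -/
theorem functionallyIndependent_chargeDensity (hN : 0 < N) (hΛ : 0 < Λ)
    (hU : ∀ θ ∈ S, IsUnit (onePlusT N Λ c θ))
    (hP : ∀ θ ∈ S, ∀ i, momentumDeriv N Λ c i θ ≠ 0) :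
    FunctionallyIndependent S fun n : Fin N => chargeDensity N Λ c n := by
  intro θ hθ
  have e : (fun n : Fin N => fun j : Fin N => pd (chargeDensity N Λ c n) j θ)
      = fun n : Fin N => fun j => momentumDeriv N Λ c j θ
        * dress N Λ c (bareCharge N Λ n) j θ := by
    funext n j
    rw [chargeDensity_eq, pd_potential (hU θ hθ)]
    simp [slope, momentumDeriv]
  rw [e]
  exact linearIndependent_smul_dress (hU θ hθ) (hP θ hθ) (linearIndependent_bareCharge hN hΛ)

theorem linearIndependent_groupVelocity (hN : 0 < N) (hΛ : 0 < Λ) {θ : Target N}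
    (h : IsUnit (onePlusT N Λ c θ)) (hP : ∀ i, momentumDeriv N Λ c i θ ≠ 0) :
    LinearIndependent ℝ fun n : Fin N => fun i : Fin N => groupVelocity N Λ c n i θ := by
  have e : (fun n : Fin N => fun i : Fin N => groupVelocity N Λ c n i θ)
      = fun n : Fin N => fun i => (momentumDeriv N Λ c i θ)⁻¹
        * dress N Λ c (fun k => node N Λ k ^ (n : ℕ)) i θ := by
    funext n i
    have : chargeDeriv N Λ ((n : ℕ) + 1) = fun k => node N Λ k ^ (n : ℕ) :=
      funext fun k => chargeDeriv_succ n k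
    rw [groupVelocity, this, div_eq_inv_mul]
  rw [e]
  exact linearIndependent_smul_dress h (fun j => inv_ne_zero (hP j))
    (linearIndependent_node_pow hN hΛ)

end Algebra

end BetheBoltzmann

end

/-! ### The main theorem -/

open BetheBoltzmann in
theorem mainTheorem5 (N : ℕ) (hN : 2 ≤ N) (Λ c : ℝ) (hΛ : 0 < Λ) (hc : 0 < c)
    (S : Set (BetheBoltzmann.Target N)) (hSopen : IsOpen S) (hS0 : (0 : BetheBoltzmann.Target N) ∈ S)
    (hU : ∀ θ ∈ S, IsUnit (BetheBoltzmann.onePlusT N Λ c θ))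
    (hP : ∀ θ ∈ S, ∀ i, BetheBoltzmann.momentumDeriv N Λ c i θ ≠ 0) :
    -- one realization of the bracket for which all charges are Casimirs and all
    -- Hamiltonians generate the dressed group velocities
    (∃ D : (BetheBoltzmann.Target N → Fin N → ℝ) →ₗ[ℝ] (BetheBoltzmann.Target N → ℝ),
      BetheBoltzmann.IsInverseDx S D ∧
      (∀ n : Fin N, BetheBoltzmann.IsCasimir N Λ c S D
        (BetheBoltzmann.chargeDensity N Λ c n)) ∧
      (∀ n : Fin N, BetheBoltzmann.Generates N Λ c S D
        (BetheBoltzmann.hamiltonianDensity N Λ c n) (BetheBoltzmann.groupVelocity N Λ c n))) ∧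
    -- first integrals of the discretized Bethe-Boltzmann system
    (∀ n : Fin N,
      BetheBoltzmann.IsFirstIntegral S (BetheBoltzmann.velocity N Λ c)
        (BetheBoltzmann.chargeDensity N Λ c n) ∧
      BetheBoltzmann.IsFirstIntegral S (BetheBoltzmann.velocity N Λ c)
        (BetheBoltzmann.hamiltonianDensity N Λ c n)) ∧
    -- functional independence of the densities of the Casimirs
    BetheBoltzmann.FunctionallyIndependent S
      (fun n : Fin N => BetheBoltzmann.chargeDensity N Λ c n) ∧
    -- the dressed group velocities are commuting, pointwise independent WNS flows
    (∀ n : Fin N, BetheBoltzmann.IsWNSFlow N Λ c S (BetheBoltzmann.groupVelocity N Λ c n)) ∧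
    (∀ m n : Fin N, BetheBoltzmann.FlowsCommute S
      (BetheBoltzmann.groupVelocity N Λ c m) (BetheBoltzmann.groupVelocity N Λ c n)) ∧
    (∀ θ ∈ S, LinearIndependent ℝ fun n : Fin N =>
      fun i : Fin N => BetheBoltzmann.groupVelocity N Λ c n i θ) ∧
    -- the algebra, for every choice of the constants of integration
    (∀ D : (BetheBoltzmann.Target N → Fin N → ℝ) →ₗ[ℝ] (BetheBoltzmann.Target N → ℝ),
      BetheBoltzmann.IsInverseDx S D → ∀ m n : Fin N,
        BetheBoltzmann.BracketVanishes N Λ c S D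
          (BetheBoltzmann.chargeDensity N Λ c m) (BetheBoltzmann.chargeDensity N Λ c n) ∧
        BetheBoltzmann.BracketVanishes N Λ c S D
          (BetheBoltzmann.hamiltonianDensity N Λ c m) (BetheBoltzmann.chargeDensity N Λ c n) ∧
        BetheBoltzmann.BracketVanishes N Λ c S D
          (BetheBoltzmann.hamiltonianDensity N Λ c m)
          (BetheBoltzmann.hamiltonianDensity N Λ c n)) := by
  have hN0 : 0 < N := by omega
  obtain ⟨D, hD, hDp⟩ := exists_isInverseDx_primitive hΛ hc hSopen hS0 hU hP
  refine ⟨⟨D, hD, fun n => ?_, fun n => ?_⟩, fun n => ⟨?_, ?_⟩,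
    functionallyIndependent_chargeDensity hN0 hΛ hU hP,
    fun n => isWNSFlow_groupVelocity hSopen hU hP n,
    fun m n => flowsCommute_groupVelocity hU hP m n,
    fun θ hθ => linearIndependent_groupVelocity hN0 hΛ (hU θ hθ) (hP θ hθ),
    fun D hD m n => ⟨?_, ?_, ?_⟩⟩
  · rw [chargeDensity_eq]
    refine ⟨inDomain_potential hU hP _ _, fun u hu i x => ?_⟩
    rw [hamVector_potential_of_primitive hU hP (hDp _ _) hu]
    -- Charges have `a = 0`, so the dressed velocity numerator vanishes.
    simp [dress]
  · rw [hamiltonianDensity_eq]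
    exact ⟨inDomain_potential hU hP _ _, fun u hu i x =>
      hamVector_potential_of_primitive hU hP (hDp _ _) hu i x⟩
  · rw [chargeDensity_eq]
    exact isFirstIntegral_potential hU hP _ _
  · rw [hamiltonianDensity_eq]
    exact isFirstIntegral_potential hU hP _ _
  · simp only [chargeDensity_eq]
    exact bracketVanishes_potential hU hP hD _ _ _ _
  · simp only [chargeDensity_eq, hamiltonianDensity_eq]
    exact bracketVanishes_potential hU hP hD _ _ _ _
  · simp only [hamiltonianDensity_eq]
    exact bracketVanishes_potential hU hP hD _ _ _ _
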